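/- Let $\kappa>0$, $\rho=-\frac{\kappa+4}{2}$, $c=13-6\frac{\kappa}{4}-6\frac{4}{\kappa}$, $h_{r,s}=\frac{\kappa}{16}(r^2-1)-\frac12(rs-1)+\frac{1}{\kappa}(s^2-1)$, $h_x=h_{1,2}=\frac{6-\kappa}{2\kappa}$ and $h_y=\frac{\rho(\rho+4-\kappa)}{4\kappa}$. On $\mathcal F=C^\infty(\{(x,y)\in\mathbb R^2: x\ne y\})[a_2,a_3,a_4,\ldots]$ (complex valued functions) consider the operators $$L_2=-\partial_{a_2}+\sum_{l\ge4}(l-3)a_{l-2}\,\partial_{a_l},\qquad L_1=\sum_{l\ge3}(l-2)a_{l-1}\,\partial_{a_l}+\partial_x+\partial_y,$$ $$L_0=\sum_{l\ge2}l\,a_l\,\partial_{a_l}+x\partial_x+y\partial_y+h_x+h_y,$$ $$L_{-1}=\sum_{l\ge2}\Big((l+2)a_{l+1}+\sum_{m_1+m_2=l+1}a_{m_1}a_{m_2}\Big)\partial_{a_l}+(x^2-3a_2)\partial_x+(y^2-3a_2)\partial_y+2xh_x+2yh_y,$$ $$L_{-2}=\sum_{l\ge2}\Big((l+4)a_{l+2}-4a_2a_l+3\!\!\sum_{m_1+m_2=l+2}\!\!a_{m_1}a_{m_2}+\!\!\sum_{m_1+m_2+m_3=l+2}\!\!a_{m_1}a_{m_2}a_{m_3}\Big)\partial_{a_l}+(x^3-4xa_2-5a_3)\partial_x+(y^3-4ya_2-5a_3)\partial_y+(3x^2-4a_2)h_x+(3y^2-4a_2)h_y-\tfrac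 c2a_2$$ (all $m_j\ge2$), and, for $n>2$, $L_n=\frac{1}{(n-2)!}[\cdots[[L_2,L_1],L_1]\cdots,L_1]$ and $L_{-n}=\frac1{(n-2)!}[L_{-1},[L_{-1},\cdots[L_{-1},L_{-2}]\cdots]]$ with $n-2$ brackets. Let $\mathcal U w\subset\mathcal F$ be the subspace of all $u\,w$ with $u$ a polynomial in the operators $L_n$, $n\in\mathbb Z$. The space of local martingales of SLE$_\kappa(\rho)$ is the kernel of $$A_{\kappa;\rho}=\frac\kappa2\partial_x^2+\frac{2}{y-x}\partial_y-\frac{\rho(\rho+4-\kappa)/(2\kappa)}{(y-x)^2}+2\sum_{l\ge2}\Big(\sum_{0\le m\le l-2,\;0\le r\le\lfloor (l-2-m)/2\rfloor}x^m(-1)^r\frac{(m+r)!}{m!\,r!}\sum_{k_1,\ldots,k_r\ge2,\ \sum k_j=l-m-2}a_{k_1}\cdots a_{k_r}\Big)\partial_{a_l}.$$ A highest weight (or singular) vector of weight $h$ is a $w\ne0$ with $L_0w=hw$ and $L_nw=0$ for all $n>0$. Powers and logarithms of $x-y$ are taken in the principal branch where $x<y$. Then the following hold. 1. The partition function $Z=(x-y)^{\rho/\kappa}=(x-y)^{-\frac12-\frac2\kappa}$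 lies in $\mathrm{Ker}\,A_{\kappa;\rho}$ and is a highest weight vector of weight $h_{2,1}=\frac{3\kappa-8}{16}$. 2. $(L_{-1}^2-\frac\kappa4L_{-2})Z=\frac{(\kappa-4)(\kappa-2)(\kappa+4)}{2\kappa^2}(x-y)^{\frac32-\frac2\kappa}$, and if $\kappa\notin\{2,4\}$ this is a (nonzero) singular vector of weight $h_{2,1}+2$. 3. The function $$\Lambda=\frac{(\kappa-4)(\kappa-2)(\kappa+4)}{2\kappa^2}\Big((x-y)^{\frac{3\kappa-4}{2\kappa}}\log(x-y)+(x-y)^{\frac{-\kappa-4}{2\kappa}}\,\frac{4\kappa x^2-(4\kappa+\kappa^2)y^2}{16}\Big)$$ lies in $\mathrm{Ker}\,A_{\kappa;\rho}$ and satisfies $(L_0-h_{2,1}-2)\Lambda=(L_{-1}^2-\frac\kappa4L_{-2})Z$; if $\kappa\ne\frac83$, then $L_n\Lambda\in\mathcal UZ$ for all $n>0$. 4. $(L_1^2-\frac\kappa4L_2)\Lambda=\beta Z$ with $\beta=-\frac1{16}(\kappa-4)(\kappa-2)(\kappa+4)$. 5. If $\kappa\notin\{2,4,\frac83\}$, then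 $\mathcal U\Lambda$ is a staggered module: $\mathcal UZ\subset\mathcal U\Lambda$ is a highest weight module of highest weight $h_{2,1}$, $\mathcal U\Lambda/\mathcal UZ$ is a highest weight module of highest weight $h_{2,1}+2$, and $L_0$ is not diagonalizable on $\mathcal U\Lambda$. Its logarithmic coupling is $\beta$: with $\chi=L_{-1}^2-\frac\kappa4L_{-2}$ and $\chi^\dagger=L_1^2-\frac\kappa4L_2$ there are a highest weight vector $\xi$ generating $\mathcal UZ$ and an $\eta\in\mathcal U\Lambda$ representing a highest weight vector that generates the quotient, such that $(L_0-h_{2,1}-2)\eta=\chi\xi$ is a (nonzero) singular vector and $\chi^\dagger\eta=\beta\xi$. -/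

import Mathlib

open scoped ContDiff

noncomputable section

namespace SLEVir

/-! ### The function space `𝓕 = C^∞({(x, y) ∈ ℝ² : x ≠ y})[a₂, a₃, a₄, …]` -/

/-- The domain `{(x, y) ∈ ℝ² : x ≠ y}`. -/
def Dom : Set (ℝ × ℝ) := {p | p.1 ≠ p.2}

lemma isOpen_Dom : IsOpen Dom := isOpen_ne_fun continuous_fst continuous_snd

/-- Extension by zero of a function on `Dom` to the plane. -/
def ext0 (f : Dom → ℂ) : ℝ × ℝ → ℂ := Function.extend Subtype.val f 0

lemma ext0_apply (f : Dom → ℂ) (p : Dom) : ext0 f p = f p :=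
  Subtype.val_injective.extend_apply f 0 p

lemma contDiffOn_ext0_iff {f : Dom → ℂ} {g : ℝ × ℝ → ℂ} (h : ∀ p : Dom, f p = g p) :
    ContDiffOn ℝ ∞ (ext0 f) Dom ↔ ContDiffOn ℝ ∞ g Dom :=
  contDiffOn_congr fun p hp => (ext0_apply f ⟨p, hp⟩).trans (h ⟨p, hp⟩)

/-- Complex valued smooth functions on `Dom`, as a subalgebra of all functions. -/
def smoothSubalgebra : Subalgebra ℂ (Dom → ℂ) where
  carrier := {f | ContDiffOn ℝ ∞ (ext0 f) Dom}
  mul_mem' {f g} hf hg := by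
    refine (contDiffOn_ext0_iff (g := fun p => ext0 f p * ext0 g p) fun p => ?_).2 (hf.mul hg)
    simp [ext0_apply]
  add_mem' {f g} hf hg := by
    refine (contDiffOn_ext0_iff (g := fun p => ext0 f p + ext0 g p) fun p => ?_).2 (hf.add hg)
    simp [ext0_apply]
  algebraMap_mem' c :=
    (contDiffOn_ext0_iff (g := fun _ => c) fun _ => rfl).2 contDiffOn_const

/-- The algebra `C^∞(Dom)` of complex valued smooth functions on `Dom`. -/
def Smooth : Type := smoothSubalgebra

instance : CommRing Smooth := inferInstanceAs (CommRing smoothSubalgebra)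

instance : Algebra ℂ Smooth := inferInstanceAs (Algebra ℂ smoothSubalgebra)

/-- The derivative of a function in `C^∞(Dom)` in the direction `v`. -/
def dirDeriv (v : ℝ × ℝ) : Smooth →ₗ[ℂ] Smooth where
  toFun f := ⟨fun p => fderiv ℝ (ext0 f.1) p v, by
    refine (contDiffOn_ext0_iff (g := fun p => fderiv ℝ (ext0 f.1) p v) fun _ => rfl).2 ?_
    exact (f.2.fderiv_of_isOpen (m := ∞) isOpen_Dom (by simp)).clm_apply contDiffOn_const⟩
  map_add' f g := by
    refine Subtype.ext (funext fun p => ?_)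
    have hd (f : Smooth) : DifferentiableAt ℝ (ext0 f.1) p :=
      (f.2.contDiffAt (isOpen_Dom.mem_nhds p.2)).differentiableAt (by simp)
    have he : ext0 (f + g).1 = ext0 f.1 + ext0 g.1 := by
      funext q
      by_cases hq : q ∈ Dom
      · have := ext0_apply (f + g).1 ⟨q, hq⟩
        have h1 := ext0_apply f.1 ⟨q, hq⟩
        have h2 := ext0_apply g.1 ⟨q, hq⟩
        rw [this, Pi.add_apply, h1, h2]
        rfl
      · simp [ext0, hq]
    change fderiv ℝ (ext0 (f + g).1) p v = fderiv ℝ (ext0 f.1) p v + fderiv ℝ (ext0 g.1) p v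
    rw [he, fderiv_add (hd f) (hd g)]
    rfl
  map_smul' c f := by
    refine Subtype.ext (funext fun p => ?_)
    have hd : DifferentiableAt ℝ (ext0 f.1) p :=
      (f.2.contDiffAt (isOpen_Dom.mem_nhds p.2)).differentiableAt (by simp)
    have he : ext0 (c • f).1 = c • ext0 f.1 := by
      funext q
      by_cases hq : q ∈ Dom
      · have := ext0_apply (c • f).1 ⟨q, hq⟩
        have h1 := ext0_apply f.1 ⟨q, hq⟩
        rw [this, Pi.smul_apply, h1]
        rfl
      · simp [ext0, hq]
    change fderiv ℝ (ext0 (c • f).1) p v = c * fderiv ℝ (ext0 f.1) p v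
    rw [he, fderiv_const_smul hd]
    rfl

/-- The indices `l ≥ 2` of the formal variables `a_l`. -/
abbrev Idx := {l : ℕ // 2 ≤ l}

/-- `𝓕 = C^∞({(x, y) : x ≠ y})[a₂, a₃, a₄, …]`. -/
abbrev 𝓕 := MvPolynomial Idx Smooth

/-- The variable `a_l` for `l ≥ 2`. With the convention `a₀ = a₁ = 0`, a sum of products
`a_{m₁} ⋯ a_{m_r}` over all `m_j ≥ 0` is the sum over `m_j ≥ 2`. -/
def a (l : ℕ) : 𝓕 := if h : 2 ≤ l then MvPolynomial.X ⟨l, h⟩ else 0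

/-- A smooth function of `(x, y)` as an element of `𝓕` without `a`-dependence. -/
def coe (f : Smooth) : 𝓕 := MvPolynomial.C f

/-! ### Explicit functions -/

/-- The coordinate function `x`. -/
def xS : Smooth := ⟨fun p => (p.1.1 : ℂ),
  (contDiffOn_ext0_iff (g := fun p => (p.1 : ℂ)) fun _ => rfl).2
    (Complex.ofRealCLM.contDiff.comp contDiff_fst).contDiffOn⟩

/-- The coordinate function `y`. -/
def yS : Smooth := ⟨fun p => (p.1.2 : ℂ),
  (contDiffOn_ext0_iff (g := fun p => (p.2 : ℂ)) fun _ => rfl).2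
    (Complex.ofRealCLM.contDiff.comp contDiff_snd).contDiffOn⟩

/-- A function `g (x - y)` of the difference. -/
def ofDiff (g : ℝ → ℂ) (hg : ContDiffOn ℝ ∞ g {0}ᶜ) : Smooth :=
  ⟨fun p => g (p.1.1 - p.1.2),
    (contDiffOn_ext0_iff (g := fun p => g (p.1 - p.2)) fun _ => rfl).2
      (hg.comp (contDiff_fst.sub contDiff_snd).contDiffOn fun _ hp => sub_ne_zero.2 hp)⟩

lemma contDiffOn_log : ContDiffOn ℝ ∞ (fun d : ℝ => Complex.log (d : ℂ)) {0}ᶜ := by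
  intro d hd
  refine ContDiffAt.contDiffWithinAt ?_
  have hcast (n : ℝ → ℝ) (hn : ContDiffAt ℝ ∞ n d) : ContDiffAt ℝ ∞ (fun t => (n t : ℂ)) d :=
    Complex.ofRealCLM.contDiff.contDiffAt.comp d hn
  rcases lt_or_gt_of_ne (show d ≠ 0 from hd) with h | h
  · have : ContDiffAt ℝ ∞ (fun t : ℝ => ((Real.log t : ℝ) : ℂ) + (Real.pi : ℂ) * Complex.I) d :=
      (hcast _ (Real.contDiffAt_log.2 hd)).add contDiffAt_const
    refine this.congr_of_eventuallyEq ?_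
    filter_upwards [eventually_lt_nhds h] with t ht
    apply Complex.ext
    · simp [Complex.log_re]
    · simp [Complex.log_im, Complex.arg_ofReal_of_neg ht]
  · refine (hcast _ (Real.contDiffAt_log.2 hd)).congr_of_eventuallyEq ?_
    filter_upwards [eventually_gt_nhds h] with t ht
    exact (Complex.ofReal_log ht.le).symm

lemma contDiffOn_cpow (s : ℂ) : ContDiffOn ℝ ∞ (fun d : ℝ => (d : ℂ) ^ s) {0}ᶜ := by
  have h : ContDiffOn ℝ ∞ (fun d : ℝ => Complex.exp (Complex.log (d : ℂ) * s)) {0}ᶜ :=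
    (contDiffOn_log.mul contDiffOn_const).cexp
  refine h.congr fun d hd => ?_
  exact Complex.cpow_def_of_ne_zero (Complex.ofReal_ne_zero.2 hd) s

lemma contDiffOn_neg_inv : ContDiffOn ℝ ∞ (fun d : ℝ => (-(d : ℂ))⁻¹) {0}ᶜ :=
  (Complex.ofRealCLM.contDiff.neg.contDiffOn).inv fun _ hd => by simpa using hd

/-- `(x - y) ^ s`, with the principal branch where `x < y`. -/
def powXY (s : ℝ) : Smooth := ofDiff (fun d => (d : ℂ) ^ (s : ℂ)) (contDiffOn_cpow s)

/-- `log (x - y)`, with the principal branch where `x < y`. -/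
def logXY : Smooth := ofDiff (fun d => Complex.log (d : ℂ)) contDiffOn_log

/-- `1 / (y - x)`. -/
def invYX : Smooth := ofDiff (fun d => (-(d : ℂ))⁻¹) contDiffOn_neg_inv

/-! ### Differential operators on `𝓕` -/

/-- Linear operators on `𝓕`; the product is composition and `⁅·, ·⁆` the commutator. -/
abbrev Op := Module.End ℂ 𝓕

/-- A linear operator on `C^∞(Dom)` applied to each coefficient of a polynomial in the `a_l`. -/
def coeffwise (D : Smooth →ₗ[ℂ] Smooth) : Op where
  toFun φ := AddMonoidAlgebra.map D.toAddMonoidHom φ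
  map_add' φ ψ := AddMonoidAlgebra.map_add _ φ ψ
  map_smul' c φ := by
    apply AddMonoidAlgebra.ext
    refine Finsupp.ext fun m => ?_
    exact D.map_smul c _

/-- `∂/∂x`. -/
def dX : Op := coeffwise (dirDeriv (1, 0))

/-- `∂/∂y`. -/
def dY : Op := coeffwise (dirDeriv (0, 1))

/-- `∑_{l ≥ 2} b_l ∂/∂a_l`. -/
def vecA (b : ℕ → 𝓕) : Op :=
  (MvPolynomial.mkDerivation Smooth (fun l : Idx => b l)).toLinearMap.restrictScalars ℂ

/-- Multiplication by an element of `𝓕`. -/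
def mulOp (φ : 𝓕) : Op := LinearMap.mulLeft ℂ φ

/-- `∑_{k₁ + ⋯ + k_r = n, k_j ≥ 2} a_{k₁} ⋯ a_{k_r}`. -/
def aSum (r n : ℕ) : 𝓕 := ∑ k ∈ Finset.Nat.antidiagonalTuple r n, ∏ j, a (k j)

/-- `x` as an element of `𝓕`. -/
def x : 𝓕 := coe xS

/-- `y` as an element of `𝓕`. -/
def y : 𝓕 := coe yS

/-- The constant `t` as an element of `𝓕`. -/
def const (t : ℂ) : 𝓕 := algebraMap ℂ 𝓕 t

/-- `L₂`. -/
def opL2 : Op := vecA fun l => if l = 2 then -1 else ((l : 𝓕) - 3) * a (l - 2)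

/-- `L₁`. -/
def opL1 : Op := vecA (fun l => ((l : 𝓕) - 2) * a (l - 1)) + dX + dY

/-- `L₀`. -/
def opL0 (hx hy : ℂ) : Op :=
  vecA (fun l => (l : 𝓕) * a l) + mulOp x * dX + mulOp y * dY + mulOp (const (hx + hy))

/-- `L₋₁`. -/
def opLm1 (hx hy : ℂ) : Op :=
  vecA (fun l => ((l : 𝓕) + 2) * a (l + 1) + aSum 2 (l + 1))
    + mulOp (x ^ 2 - 3 * a 2) * dX + mulOp (y ^ 2 - 3 * a 2) * dY
    + mulOp (2 * x * const hx + 2 * y * const hy)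

/-- `L₋₂`. -/
def opLm2 (c hx hy : ℂ) : Op :=
  vecA (fun l => ((l : 𝓕) + 4) * a (l + 2) - 4 * a 2 * a l + 3 * aSum 2 (l + 2) + aSum 3 (l + 2))
    + mulOp (x ^ 3 - 4 * x * a 2 - 5 * a 3) * dX
    + mulOp (y ^ 3 - 4 * y * a 2 - 5 * a 3) * dY
    + mulOp ((3 * x ^ 2 - 4 * a 2) * const hx + (3 * y ^ 2 - 4 * a 2) * const hy
        - const (c / 2) * a 2)

/-- The operators `L_n`, `n ∈ ℤ`, with
`L_n = [⋯[[L₂, L₁], L₁]⋯, L₁] / (n-2)!` and `L_{-n} = [L₋₁, [L₋₁, ⋯[L₋₁, L₋₂]⋯]] / (n-2)!`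
(`n - 2` brackets) for `n > 2`. -/
def opL (c hx hy : ℂ) : ℤ → Op
  | Int.ofNat 0 => opL0 hx hy
  | Int.ofNat 1 => opL1
  | Int.ofNat (k + 2) => ((k.factorial : ℂ)⁻¹) • (fun T : Op => ⁅T, opL1⁆)^[k] opL2
  | Int.negSucc 0 => opLm1 hx hy
  | Int.negSucc (k + 1) =>
      ((k.factorial : ℂ)⁻¹) • (fun T : Op => ⁅opLm1 hx hy, T⁆)^[k] (opLm2 c hx hy)

/-- The central charge `c(κ) = 13 - 6 κ/4 - 6 · 4/κ`. -/
def centralCharge (κ : ℝ) : ℝ := 13 - 6 * (κ / 4) - 6 * (4 / κ)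

/-- The Kac weights `h_{r,s}(κ)`. -/
def kacWeight (κ : ℝ) (r s : ℤ) : ℝ :=
  (κ / 4) / 4 * ((r : ℝ) ^ 2 - 1) - 1 / 2 * ((r : ℝ) * s - 1) + (4 / κ) / 4 * ((s : ℝ) ^ 2 - 1)

/-- The Virasoro generators on `𝓕` associated with SLE`_κ(ρ)`, that is `c = c(κ)`,
`h_x = h_{1,2}(κ)` and `h_y = ρ (ρ + 4 - κ) / (4 κ)`. -/
def vir (κ ρ : ℝ) : ℤ → Op :=
  opL (centralCharge κ : ℝ) (kacWeight κ 1 2 : ℝ) (ρ * (ρ + 4 - κ) / (4 * κ) : ℝ)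

/-- The drift operator `A_{κ;ρ}`: for SLE`_κ(ρ)` and `φ ∈ 𝓕`, the drift of
`φ(X_t, Y_t, a₂(t), a₃(t), …) / Z(X_t, Y_t)` is `(A_{κ;ρ} φ) / Z`. -/
def opA (κ ρ : ℝ) : Op :=
  ((κ / 2 : ℝ) : ℂ) • (dX * dX) + mulOp (2 * coe invYX) * dY
    - mulOp (const (ρ * (ρ + 4 - κ) / (2 * κ) : ℝ) * coe invYX ^ 2)
    + vecA (fun l => 2 * ∑ m ∈ Finset.range (l - 1), ∑ r ∈ Finset.range ((l - 2 - m) / 2 + 1),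
        x ^ m * (-1) ^ r * const (((m + r).factorial : ℂ) / (m.factorial * r.factorial))
          * aSum r (l - m - 2))

/-- The space `Ker A_{κ;ρ}` of local martingales of SLE`_κ(ρ)`. -/
def localMartingales (κ ρ : ℝ) : Submodule ℂ 𝓕 := LinearMap.ker (opA κ ρ)

/-- The partition function `Z = (x - y)^{ρ/κ}` of SLE`_κ(ρ)`. -/
def partitionFunction (κ ρ : ℝ) : 𝓕 := coe (powXY (ρ / κ))

/-! ### Highest weight vectors, staggered modules, logarithmic couplings

`L : ℤ → Module.End ℂ V` is the family of operators by which the Virasoro generators `L_n` act. -/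

section Modules

variable {V : Type*} [AddCommGroup V] [Module ℂ V] (L : ℤ → Module.End ℂ V)

/-- The submodule `𝒰 w` generated by `w`: all `u w` with `u` a polynomial in the `L_n`. -/
def generated (w : V) : Submodule ℂ V :=
  (Subalgebra.toSubmodule (Algebra.adjoin ℂ (Set.range L))).map (LinearMap.applyₗ w)

/-- `w` is a (nonzero) singular vector of weight `h`, i.e. the highest weight vector of the
highest weight module `𝒰 w`. -/
def IsHighestWeightVector (h : ℂ) (w : V) : Prop :=
  w ≠ 0 ∧ L 0 w = h • w ∧ ∀ n : ℤ, 0 < n → L n w = 0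

/-- For a submodule `H` of a module `S`: the class of `w ∈ S` in the quotient `S / H` is nonzero,
is a highest weight vector of weight `h`, and generates `S / H`. -/
def IsHighestWeightVectorMod (H S : Submodule ℂ V) (h : ℂ) (w : V) : Prop :=
  w ∈ S ∧ w ∉ H ∧ L 0 w - h • w ∈ H ∧ (∀ n : ℤ, 0 < n → L n w ∈ H) ∧ H ⊔ generated L w = S

/-- `S` is a staggered module with left module `H`, a highest weight module of highest weight
`hL`, and with right module `S / H`, a highest weight module of highest weight `hR`;
and `L₀` is not diagonalizable on `S`. -/
def IsStaggered (H S : Submodule ℂ V) (hL hR : ℂ) : Prop :=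
  H ≤ S ∧ (∀ n : ℤ, ∀ v ∈ S, L n v ∈ S) ∧
  (∃ ξ, IsHighestWeightVector L hL ξ ∧ generated L ξ = H) ∧
  (∃ η, IsHighestWeightVectorMod L H S hR η) ∧
  (⨆ μ : ℂ, S ⊓ Module.End.eigenspace (L 0) μ) ≠ S

/-- For a staggered module `S` with left module `H`: one can choose a highest weight vector `ξ`
generating `H` and `η ∈ S` over a highest weight vector of `S / H`, normalized by
`(L₀ - hR) η = χ ξ ≠ 0`, such that `χ† η = β ξ`. Here `χ ξ` is a singular vector of `H`, and
`χd` is the operator `χ†` obtained from `χ` by `(L_{n₁} ⋯ L_{n_k})† = L_{-n_k} ⋯ L_{-n₁}`. -/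
def IsLogCoupling (H S : Submodule ℂ V) (hL hR : ℂ) (χ χd : Module.End ℂ V) (β : ℂ) : Prop :=
  ∃ ξ η : V, IsHighestWeightVector L hL ξ ∧ generated L ξ = H ∧
    IsHighestWeightVectorMod L H S hR η ∧
    IsHighestWeightVector L hR (χ ξ) ∧ L 0 η - hR • η = χ ξ ∧ χd η = β • ξ

end Modules

/-! ### The case `ρ = -(κ+4)/2` -/

/-- `(κ-4)(κ-2)(κ+4) / (2κ²)`. -/
def singConst (κ : ℝ) : ℝ := (κ - 4) * (κ - 2) * (κ + 4) / (2 * κ ^ 2)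

/-- The logarithmic partner
`Λ = (κ-4)(κ-2)(κ+4)/(2κ²) · ((x-y)^{(3κ-4)/(2κ)} log(x-y)
  + (x-y)^{(-κ-4)/(2κ)} (4κx² - (4κ+κ²)y²)/16)`. -/
def logPartner (κ : ℝ) : 𝓕 :=
  coe ((singConst κ : ℂ) •
    (powXY ((3 * κ - 4) / (2 * κ)) * logXY
      + powXY ((-κ - 4) / (2 * κ)) *
        ((1 / 16 : ℂ) • ((4 * κ : ℂ) • xS ^ 2 - (4 * κ + κ ^ 2 : ℂ) • yS ^ 2))))

end SLEVir

end

/-! The functions Z, Λ and χZ do not involve the variables a_l, and on such functions half of the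
algebra is trivial: L₁ acts as the translation field ∂x+∂y and every L_n with n ≥ 2 acts as zero
(`opL_coe_of_two_le`). A power of x-y is translation invariant, so Z and χZ are singular as soon as
their L₀-weights are right. In Λ, translation only sees the quadratic polynomial, which gives L₁Λ
and χ†Λ = βZ.

The exponents of Z and χZ differ by 2 and are the two roots of the indicial equation of the drift
operator. The logarithm attached to the larger root is compensated by the quadratic term of Λ, and
the Euler field applied to this logarithm produces the Jordan block (L₀-h-2)Λ = χZ. These facts are
pointwise identities (`singular_fZ`, `opA_fΛ`, `opL0_fΛ`, `opL1_fRais`, `coe_fRais`).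

For the module structure the full Virasoro relations are not needed, only the grading [L₀,L_n] =
-nL_n (`hasDegree_opL`). It makes L₀ diagonalizable on 𝒰Z (`generated_le_iSup_eigenspace`), whereas
a vector with a nontrivial Jordan block is in no sum of eigenspaces
(`sub_smul_eq_zero_of_mem_iSup_eigenspace`). Hence Λ is not in 𝒰Z and L₀ is not diagonalizable on
𝒰Λ. Since β ≠ 0, Z is recovered from Λ by χ†, so 𝒰Z ⊆ 𝒰Λ. -/

noncomputable section

namespace SLEVir

/-! ### Calculus on `C^∞(Dom)` -/

/-- Evaluation of a smooth function at a point of `Dom`. -/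
def ev (p : Dom) : Smooth →ₐ[ℂ] ℂ :=
  (Pi.evalAlgHom ℂ (fun _ : Dom => ℂ) p).comp smoothSubalgebra.val

lemma smooth_ext {f g : Smooth} (h : ∀ p, ev p f = ev p g) : f = g :=
  Subtype.ext (funext h)

lemma ext0_eventuallyEq {f : Dom → ℂ} {g : ℝ × ℝ → ℂ} (h : ∀ p : Dom, f p = g p) (p : Dom) :
    ext0 f =ᶠ[nhds p.1] g := by
  filter_upwards [isOpen_Dom.mem_nhds p.2] with q hq
  exact (ext0_apply f ⟨q, hq⟩).trans (h ⟨q, hq⟩)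

lemma contDiffAt_ext0 (f : Smooth) (p : Dom) : ContDiffAt ℝ ∞ (ext0 f.1) p :=
  f.2.contDiffAt (isOpen_Dom.mem_nhds p.2)

lemma differentiableAt_ext0 (f : Smooth) (p : Dom) : DifferentiableAt ℝ (ext0 f.1) p :=
  (contDiffAt_ext0 f p).differentiableAt (by simp)

lemma ev_dirDeriv (v : ℝ × ℝ) (f : Smooth) (p : Dom) :
    ev p (dirDeriv v f) = fderiv ℝ (ext0 f.1) p v := rfl

/-- `Dom` is open, so the zero extension agrees with `g` near `p`; any explicit formula can thus be
differentiated in place of `ext0 f`. -/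
lemma ev_dirDeriv_of_hasFDerivAt {v : ℝ × ℝ} {f : Smooth} {g : ℝ × ℝ → ℂ} {p : Dom}
    {g' : ℝ × ℝ →L[ℝ] ℂ} (h : ∀ q : Dom, ev q f = g q) (hg : HasFDerivAt g g' p) :
    ev p (dirDeriv v f) = g' v := by
  exact DFunLike.congr_fun ((ext0_eventuallyEq (f := f.1) h p).fderiv_eq.trans hg.fderiv) v

lemma dirDeriv_mul (v : ℝ × ℝ) (f g : Smooth) :
    dirDeriv v (f * g) = f * dirDeriv v g + g * dirDeriv v f := by
  refine smooth_ext fun p => ?_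
  rw [ev_dirDeriv_of_hasFDerivAt (g := fun q => ext0 f.1 q * ext0 g.1 q) (fun q => ?_)
    ((differentiableAt_ext0 f p).hasFDerivAt.mul (differentiableAt_ext0 g p).hasFDerivAt)]
  · simp only [map_add, map_mul, ev_dirDeriv, ext0_apply]
    rfl
  · simp only [map_mul, ext0_apply]
    rfl

/-- The directional derivative as a derivation. -/
def dirDer (v : ℝ × ℝ) : Derivation ℂ Smooth Smooth :=
  Derivation.mk' (dirDeriv v) (dirDeriv_mul v)

lemma dirDeriv_one (v : ℝ × ℝ) : dirDeriv v 1 = 0 := (dirDer v).map_one_eq_zero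

lemma dirDeriv_comm (v w : ℝ × ℝ) (f : Smooth) :
    dirDeriv v (dirDeriv w f) = dirDeriv w (dirDeriv v f) := by
  have key (v w : ℝ × ℝ) (p : Dom) : ev p (dirDeriv v (dirDeriv w f))
      = fderiv ℝ (fderiv ℝ (ext0 f.1)) p v w := by
    have hd : DifferentiableAt ℝ (fderiv ℝ (ext0 f.1)) p :=
      ((contDiffAt_ext0 f p).fderiv_right (m := 1) (by norm_cast)).differentiableAt (by simp)
    rw [ev_dirDeriv_of_hasFDerivAt (g := fun q => fderiv ℝ (ext0 f.1) q w) (fun q => rfl)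
      (hd.hasFDerivAt.clm_apply (hasFDerivAt_const w _))]
    simp
  refine smooth_ext fun p => ?_
  rw [key, key]
  exact ((contDiffAt_ext0 f p).isSymmSndFDerivAt (by simp; norm_cast)) v w

lemma dirDeriv_xS (v : ℝ × ℝ) : dirDeriv v xS = algebraMap ℂ Smooth v.1 := by
  refine smooth_ext fun p => ?_
  rw [ev_dirDeriv_of_hasFDerivAt (g := fun q => (q.1 : ℂ)) (fun q => rfl)
    (Complex.ofRealCLM.hasFDerivAt.comp p.1 hasFDerivAt_fst), AlgHom.commutes]
  rfl

lemma dirDeriv_yS (v : ℝ × ℝ) : dirDeriv v yS = algebraMap ℂ Smooth v.2 := by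
  refine smooth_ext fun p => ?_
  rw [ev_dirDeriv_of_hasFDerivAt (g := fun q => (q.2 : ℂ)) (fun q => rfl)
    (Complex.ofRealCLM.hasFDerivAt.comp p.1 hasFDerivAt_snd), AlgHom.commutes]
  rfl

lemma dirDeriv_ofDiff (v : ℝ × ℝ) {g g' : ℝ → ℂ} (hg : ContDiffOn ℝ ∞ g {0}ᶜ)
    (hd : ∀ d : ℝ, d ≠ 0 → HasDerivAt g (g' d) d) (p : Dom) :
    ev p (dirDeriv v (ofDiff g hg)) = (v.1 - v.2 : ℝ) * g' (p.1.1 - p.1.2) := by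
  have h0 : p.1.1 - p.1.2 ≠ 0 := sub_ne_zero.2 p.2
  rw [ev_dirDeriv_of_hasFDerivAt (g := fun q => g (q.1 - q.2)) (fun q => rfl)
    ((hd _ h0).hasFDerivAt.comp p.1 (hasFDerivAt_fst.sub hasFDerivAt_snd))]
  simp [sub_mul]

/-- `x - y`, at a point of `Dom`. -/
def diff (p : Dom) : ℂ := (p.1.1 : ℂ) - p.1.2

lemma diff_ne_zero (p : Dom) : diff p ≠ 0 := by
  rw [diff, ← Complex.ofReal_sub, Complex.ofReal_ne_zero]
  exact sub_ne_zero.2 p.2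

lemma ev_xS (p : Dom) : ev p xS = p.1.1 := rfl

lemma ev_yS (p : Dom) : ev p yS = p.1.2 := rfl

lemma ev_powXY (s : ℝ) (p : Dom) : ev p (powXY s) = diff p ^ (s : ℂ) := by
  rw [diff, ← Complex.ofReal_sub]
  rfl

lemma ev_logXY (p : Dom) : ev p logXY = Complex.log (diff p) := by
  rw [diff, ← Complex.ofReal_sub]
  rfl

lemma ev_invYX (p : Dom) : ev p invYX = -(diff p)⁻¹ := by
  rw [← inv_neg, diff, ← Complex.ofReal_sub]
  rfl

/-- On each half-line the principal logarithm is log|t| plus a constant, 0 or iπ, so the branch does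
not affect the derivative. -/
lemma hasDerivAt_log_ofReal {d : ℝ} (hd : d ≠ 0) :
    HasDerivAt (fun t : ℝ => Complex.log (t : ℂ)) (d : ℂ)⁻¹ d := by
  have hc := (Real.hasDerivAt_log hd).ofReal_comp
  rw [Complex.ofReal_inv] at hc
  rcases lt_or_gt_of_ne hd with h | h
  · refine (hc.add_const ((Real.pi : ℂ) * Complex.I)).congr_of_eventuallyEq ?_
    filter_upwards [eventually_lt_nhds h] with t ht
    apply Complex.ext
    · simp [Complex.log_re]
    · simp [Complex.log_im, Complex.arg_ofReal_of_neg ht]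
  · refine hc.congr_of_eventuallyEq ?_
    filter_upwards [eventually_gt_nhds h] with t ht
    exact (Complex.ofReal_log ht.le).symm

lemma hasDerivAt_cpow_ofReal (s : ℂ) {d : ℝ} (hd : d ≠ 0) :
    HasDerivAt (fun t : ℝ => (t : ℂ) ^ s) (s * (d : ℂ) ^ s * (d : ℂ)⁻¹) d := by
  have h := ((hasDerivAt_log_ofReal hd).mul_const s).cexp
  rw [← Complex.cpow_def_of_ne_zero (Complex.ofReal_ne_zero.2 hd) s] at h
  refine (h.congr_of_eventuallyEq ?_).congr_deriv (by ring)
  filter_upwards [eventually_ne_nhds hd] with t ht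
  exact Complex.cpow_def_of_ne_zero (Complex.ofReal_ne_zero.2 ht) s

lemma dirDeriv_powXY (v : ℝ × ℝ) (s : ℝ) :
    dirDeriv v (powXY s) = ((v.2 - v.1 : ℝ) * (s : ℂ)) • (powXY s * invYX) := by
  refine smooth_ext fun p => ?_
  rw [powXY, dirDeriv_ofDiff v _ fun d hd => hasDerivAt_cpow_ofReal s hd, map_smul, map_mul,
    ev_invYX, ← powXY, ev_powXY, diff]
  push_cast
  rw [smul_eq_mul]
  ring

lemma dirDeriv_logXY (v : ℝ × ℝ) : dirDeriv v logXY = ((v.2 - v.1 : ℝ) : ℂ) • invYX := by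
  refine smooth_ext fun p => ?_
  rw [logXY, dirDeriv_ofDiff v _ fun d hd => hasDerivAt_log_ofReal hd, map_smul, ev_invYX, diff]
  push_cast
  rw [smul_eq_mul]
  ring

lemma dirDeriv_invYX (v : ℝ × ℝ) :
    dirDeriv v invYX = ((v.1 - v.2 : ℝ) : ℂ) • invYX ^ 2 := by
  refine smooth_ext fun p => ?_
  have hd (d : ℝ) (hd : d ≠ 0) : HasDerivAt (fun t : ℝ => (-(t : ℂ))⁻¹) ((d : ℂ)⁻¹ ^ 2) d := by
    have hd' : (d : ℂ) ≠ 0 := Complex.ofReal_ne_zero.2 hd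
    refine ((Complex.ofRealCLM.hasDerivAt (x := d)).neg.inv
      (by simpa using hd)).congr_deriv ?_
    simp
  rw [invYX, dirDeriv_ofDiff v _ hd, map_smul, map_pow, ← invYX, ev_invYX, diff]
  push_cast
  rw [smul_eq_mul]
  ring

/-! ### The operators on `𝓕` as derivations -/

lemma coeffwise_monomial (D : Smooth →ₗ[ℂ] Smooth) (m : Idx →₀ ℕ) (f : Smooth) :
    coeffwise D (MvPolynomial.monomial m f) = MvPolynomial.monomial m (D f) :=
  AddMonoidAlgebra.map_single _ f m

lemma coeffwise_coe (D : Smooth →ₗ[ℂ] Smooth) (f : Smooth) :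
    coeffwise D (coe f) = coe (D f) :=
  coeffwise_monomial D 0 f

/-- Both sides are biadditive, so the Leibniz rule reduces to monomials, where it is the rule for
the coefficients. -/
lemma coeffwise_mul (D : Derivation ℂ Smooth Smooth) (φ ψ : 𝓕) :
    coeffwise D (φ * ψ) = φ * coeffwise D ψ + ψ * coeffwise D φ := by
  induction φ using MvPolynomial.induction_on' with
  | monomial m f =>
    induction ψ using MvPolynomial.induction_on' with
    | monomial n g =>
      simp only [MvPolynomial.monomial_mul, coeffwise_monomial, Derivation.coeFn_coe,
        Derivation.leibniz, smul_eq_mul, map_add, add_comm n m]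
    | add ψ₁ ψ₂ h₁ h₂ => rw [mul_add, map_add, h₁, h₂, map_add]; ring
  | add φ₁ φ₂ h₁ h₂ => rw [add_mul, map_add, h₁, h₂, map_add]; ring

/-- `∂/∂x` as a derivation. -/
def derX : Derivation ℂ 𝓕 𝓕 := Derivation.mk' dX (coeffwise_mul (dirDer (1, 0)))

/-- `∂/∂y` as a derivation. -/
def derY : Derivation ℂ 𝓕 𝓕 := Derivation.mk' dY (coeffwise_mul (dirDer (0, 1)))

/-- `∑ b_l ∂/∂a_l` as a derivation. -/
def derA (b : ℕ → 𝓕) : Derivation ℂ 𝓕 𝓕 :=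
  (MvPolynomial.mkDerivation Smooth (fun l : Idx => b l)).restrictScalars ℂ

lemma dX_coe (f : Smooth) : dX (coe f) = coe (dirDeriv (1, 0) f) := coeffwise_coe _ f

lemma dY_coe (f : Smooth) : dY (coe f) = coe (dirDeriv (0, 1) f) := coeffwise_coe _ f

lemma vecA_coe (b : ℕ → 𝓕) (f : Smooth) : vecA b (coe f) = 0 :=
  (MvPolynomial.mkDerivation Smooth (fun l : Idx => b l)).map_algebraMap f

lemma a_coe (l : Idx) : a l = MvPolynomial.X l := dif_pos l.2

lemma coeffwise_X (v : ℝ × ℝ) (l : Idx) :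
    coeffwise (dirDeriv v) (MvPolynomial.X l) = 0 := by
  rw [MvPolynomial.X, coeffwise_monomial, dirDeriv_one, map_zero]

lemma dX_X (l : Idx) : dX (MvPolynomial.X l) = 0 := coeffwise_X _ l

lemma dY_X (l : Idx) : dY (MvPolynomial.X l) = 0 := coeffwise_X _ l

lemma vecA_X (b : ℕ → 𝓕) (l : Idx) : vecA b (MvPolynomial.X l) = b l :=
  MvPolynomial.mkDerivation_X Smooth _ l

/-- The derivations are only ℂ-linear, so the coefficient functions must be tested as well as the
variables. -/
lemma derivation_ext {D₁ D₂ : Derivation ℂ 𝓕 𝓕} (hC : ∀ f, D₁ (coe f) = D₂ (coe f))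
    (hX : ∀ l : Idx, D₁ (MvPolynomial.X l) = D₂ (MvPolynomial.X l)) : D₁ = D₂ := by
  refine Derivation.ext fun φ => ?_
  induction φ using MvPolynomial.induction_on with
  | C f => exact hC f
  | add φ ψ h₁ h₂ => rw [map_add, map_add, h₁, h₂]
  | mul_X φ l h => rw [Derivation.leibniz, Derivation.leibniz, h, hX]

/-! ### Homogeneity -/

/-- The first order differential operator with coefficients `b`, `g₁`, `g₂`. -/
def firstOrder (b : ℕ → 𝓕) (g₁ g₂ : 𝓕) : Derivation ℂ 𝓕 𝓕 :=
  derA b + g₁ • derX + g₂ • derY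

lemma coe_firstOrder (b : ℕ → 𝓕) (g₁ g₂ : 𝓕) :
    (firstOrder b g₁ g₂ : Op) = vecA b + mulOp g₁ * dX + mulOp g₂ * dY := rfl

lemma firstOrder_apply (b : ℕ → 𝓕) (g₁ g₂ φ : 𝓕) :
    firstOrder b g₁ g₂ φ = vecA b φ + g₁ * dX φ + g₂ * dY φ := rfl

lemma firstOrder_coe (b : ℕ → 𝓕) (g₁ g₂ : 𝓕) (f : Smooth) :
    firstOrder b g₁ g₂ (coe f)
      = g₁ * coe (dirDeriv (1, 0) f) + g₂ * coe (dirDeriv (0, 1) f) := by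
  rw [firstOrder_apply, vecA_coe, dX_coe, dY_coe, zero_add]

lemma firstOrder_X (b : ℕ → 𝓕) (g₁ g₂ : 𝓕) (l : Idx) :
    firstOrder b g₁ g₂ (MvPolynomial.X l) = b l := by
  rw [firstOrder_apply, vecA_X, dX_X, dY_X, mul_zero, mul_zero, add_zero, add_zero]

lemma intCast_smul (n : ℤ) (φ : 𝓕) : (n : ℂ) • φ = (n : 𝓕) * φ := by
  rw [Algebra.smul_def, map_intCast]

/-- The first order part of `L₀`. -/
def euler : Derivation ℂ 𝓕 𝓕 := firstOrder (fun l => (l : 𝓕) * a l) x y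

lemma opL0_eq (hx hy : ℂ) : opL0 hx hy = (euler : Op) + mulOp (const (hx + hy)) := rfl

lemma euler_coe (f : Smooth) :
    euler (coe f) = x * coe (dirDeriv (1, 0) f) + y * coe (dirDeriv (0, 1) f) :=
  firstOrder_coe _ _ _ f

lemma euler_X (l : Idx) : euler (MvPolynomial.X l) = (l : 𝓕) * MvPolynomial.X l := by
  rw [euler, firstOrder_X, a_coe]

/-- `φ` is homogeneous of degree `n`, where `x` and `y` have degree `1` and `a_l` has
degree `l`. -/
def IsHomog (n : ℤ) (φ : 𝓕) : Prop := euler φ = (n : 𝓕) * φ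

lemma IsHomog.mul {m n : ℤ} {φ ψ : 𝓕} (hφ : IsHomog m φ) (hψ : IsHomog n ψ) :
    IsHomog (m + n) (φ * ψ) := by
  rw [IsHomog] at *
  rw [Derivation.leibniz, hφ, hψ, smul_eq_mul, smul_eq_mul]
  push_cast
  ring

lemma IsHomog.add {n : ℤ} {φ ψ : 𝓕} (hφ : IsHomog n φ) (hψ : IsHomog n ψ) :
    IsHomog n (φ + ψ) := by
  rw [IsHomog] at *
  rw [map_add, hφ, hψ, mul_add]

lemma IsHomog.neg {n : ℤ} {φ : 𝓕} (hφ : IsHomog n φ) : IsHomog n (-φ) := by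
  rw [IsHomog] at *
  rw [map_neg, hφ, mul_neg]

lemma IsHomog.sub {n : ℤ} {φ ψ : 𝓕} (hφ : IsHomog n φ) (hψ : IsHomog n ψ) :
    IsHomog n (φ - ψ) := sub_eq_add_neg φ ψ ▸ hφ.add hψ.neg

lemma isHomog_natCast (k : ℕ) : IsHomog 0 (k : 𝓕) := by
  rw [IsHomog, Derivation.map_natCast, Int.cast_zero, zero_mul]

lemma isHomog_const (t : ℂ) : IsHomog 0 (const t) := by
  rw [IsHomog, const, Derivation.map_algebraMap, Int.cast_zero, zero_mul]

lemma IsHomog.const_mul {n : ℤ} {φ ψ : 𝓕} (hφ : IsHomog 0 φ) (hψ : IsHomog n ψ) :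
    IsHomog n (φ * ψ) := by
  simpa using hφ.mul hψ

lemma isHomog_zero (n : ℤ) : IsHomog n 0 := by
  rw [IsHomog, map_zero, mul_zero]

lemma isHomog_one : IsHomog 0 1 := by
  simpa using isHomog_natCast 1

lemma IsHomog.pow {n : ℤ} {φ : 𝓕} (hφ : IsHomog n φ) (k : ℕ) : IsHomog (k * n) (φ ^ k) := by
  induction k with
  | zero => simpa using isHomog_one
  | succ k ih =>
    rw [pow_succ]
    convert ih.mul hφ using 1
    push_cast
    ring

lemma isHomog_a (l : ℕ) : IsHomog l (a l) := by
  by_cases h : 2 ≤ l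
  · have := euler_X ⟨l, h⟩
    rwa [← a_coe ⟨l, h⟩] at this
  · rw [a, dif_neg h]
    exact isHomog_zero _

lemma isHomog_x : IsHomog 1 x := by
  rw [IsHomog, x, euler_coe, dirDeriv_xS, dirDeriv_xS]
  simp [x, y, coe]

lemma isHomog_y : IsHomog 1 y := by
  rw [IsHomog, y, euler_coe, dirDeriv_yS, dirDeriv_yS]
  simp [x, y, coe]

lemma isHomog_sum {ι : Type*} {n : ℤ} (s : Finset ι) {φ : ι → 𝓕}
    (h : ∀ i ∈ s, IsHomog n (φ i)) : IsHomog n (∑ i ∈ s, φ i) := by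
  rw [IsHomog, map_sum, Finset.mul_sum]
  exact Finset.sum_congr rfl h

lemma isHomog_prod {ι : Type*} (s : Finset ι) {n : ι → ℤ} {φ : ι → 𝓕}
    (h : ∀ i ∈ s, IsHomog (n i) (φ i)) : IsHomog (∑ i ∈ s, n i) (∏ i ∈ s, φ i) := by
  classical
  induction s using Finset.induction_on with
  | empty => simpa using isHomog_one
  | insert i s hi ih =>
    rw [Finset.sum_insert hi, Finset.prod_insert hi]
    exact (h i (by simp)).mul (ih fun j hj => h j (by simp [hj]))

lemma isHomog_aSum (r n : ℕ) : IsHomog n (aSum r n) := by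
  refine isHomog_sum _ fun k hk => ?_
  rw [← Finset.Nat.mem_antidiagonalTuple.1 hk, Nat.cast_sum]
  exact isHomog_prod _ fun j _ => isHomog_a (k j)

/-- Commutator of `L₀` with a first order operator with homogeneous coefficients. -/
lemma opL0_lie_of_isHomog {hx hy : ℂ} {n : ℤ} {b : ℕ → 𝓕} {g₁ g₂ g : 𝓕}
    (hb : ∀ l : ℕ, 2 ≤ l → IsHomog (n + l) (b l)) (h₁ : IsHomog (n + 1) g₁)
    (h₂ : IsHomog (n + 1) g₂) (hg : IsHomog n g) :
    ⁅opL0 hx hy, vecA b + mulOp g₁ * dX + mulOp g₂ * dY + mulOp g⁆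
      = (n : ℂ) • (vecA b + mulOp g₁ * dX + mulOp g₂ * dY + mulOp g) := by
  set D : Derivation ℂ 𝓕 𝓕 := firstOrder b g₁ g₂ with hD
  rw [IsHomog] at h₁ h₂ hg
  -- The commutator is again a derivation, so coefficients and variables suffice. The second order
  -- terms cancel because ∂x and ∂y commute.
  have hlie : ⁅euler, D⁆ = (n : ℂ) • D := by
    refine derivation_ext (fun f => ?_) (fun l => ?_)
    · rw [Derivation.commutator_apply, Derivation.smul_apply, euler_coe, hD, firstOrder_coe,
        map_add, map_add]
      simp only [Derivation.leibniz, smul_eq_mul, h₁, h₂, euler_coe, firstOrder_coe, x, y,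
        dirDeriv_xS, dirDeriv_yS, intCast_smul]
      rw [dirDeriv_comm (0, 1) (1, 0) f]
      simp only [coe, Complex.ofReal_one, Complex.ofReal_zero, map_one, map_zero]
      push_cast
      ring
    · have hbl := hb l l.2
      rw [IsHomog] at hbl
      rw [Derivation.commutator_apply, Derivation.smul_apply, hD, firstOrder_X, hbl, euler_X,
        Derivation.leibniz, firstOrder_X, Derivation.map_natCast, intCast_smul]
      simp only [smul_eq_mul]
      push_cast
      ring
  rw [← coe_firstOrder, opL0_eq, ← hD]
  refine LinearMap.ext fun φ => ?_
  have h := DFunLike.congr_fun hlie φ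
  rw [Derivation.commutator_apply, Derivation.smul_apply, intCast_smul] at h
  have e₁ : (⁅(euler : Op) + mulOp (const (hx + hy)), (D : Op) + mulOp g⁆ : Op) φ
      = (euler (D φ + g * φ) + const (hx + hy) * (D φ + g * φ))
        - (D (euler φ + const (hx + hy) * φ) + g * (euler φ + const (hx + hy) * φ)) := rfl
  have e₂ : ((n : ℂ) • ((D : Op) + mulOp g)) φ = (n : ℂ) • (D φ + g * φ) := rfl
  -- The constant in L₀ commutes with everything; only the Euler part contributes, through the
  -- homogeneity of `g`.
  have e₃ : D (const (hx + hy)) = 0 := D.map_algebraMap _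
  rw [e₁, e₂, intCast_smul, mul_add (n : 𝓕), ← h]
  simp only [map_add, Derivation.leibniz, smul_eq_mul, hg, e₃]
  ring

/-! ### The grading by `L₀` -/

lemma isHomog_ofNat (k : ℕ) [k.AtLeastTwo] : IsHomog 0 (OfNat.ofNat k : 𝓕) := by
  have h := isHomog_natCast (OfNat.ofNat k)
  rwa [Nat.cast_ofNat] at h

lemma IsHomog.of_eq {m n : ℤ} {φ : 𝓕} (hφ : IsHomog m φ) (h : m = n) : IsHomog n φ := h ▸ hφ

/-- `S` has degree `d` for the grading given by the commutator with `E`. -/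
def HasDegree {A : Type*} [Ring A] [Algebra ℂ A] (E S : A) (d : ℂ) : Prop :=
  E * S - S * E = d • S

lemma HasDegree.lie {A : Type*} [Ring A] [Algebra ℂ A] {E S T : A} {s t : ℂ}
    (hS : HasDegree E S s) (hT : HasDegree E T t) : HasDegree E (S * T - T * S) (s + t) := by
  rw [HasDegree] at *
  have h : E * (S * T - T * S) - (S * T - T * S) * E = (E * S - S * E) * T + S * (E * T - T * E)
      - ((E * T - T * E) * S + T * (E * S - S * E)) := by noncomm_ring
  rw [h, hS, hT]
  simp only [smul_mul_assoc, mul_smul_comm]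
  module

lemma HasDegree.smul {A : Type*} [Ring A] [Algebra ℂ A] {E S : A} {s : ℂ}
    (hS : HasDegree E S s) (t : ℂ) : HasDegree E (t • S) s := by
  rw [HasDegree] at *
  rw [mul_smul_comm, smul_mul_assoc, ← smul_sub, hS, smul_comm]

lemma HasDegree.of_eq {A : Type*} [Ring A] [Algebra ℂ A] {E S : A} {s t : ℂ}
    (hS : HasDegree E S s) (h : s = t) : HasDegree E S t := h ▸ hS

/-- A first order operator with homogeneous coefficients has a degree. -/
lemma hasDegree_of_isHomog {hx hy d : ℂ} (n : ℤ) (hn : n = d) {b : ℕ → 𝓕} {g₁ g₂ g : 𝓕}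
    (hb : ∀ l : ℕ, 2 ≤ l → IsHomog (n + l) (b l)) (h₁ : IsHomog (n + 1) g₁)
    (h₂ : IsHomog (n + 1) g₂) (hg : IsHomog n g) :
    HasDegree (opL0 hx hy) (vecA b + mulOp g₁ * dX + mulOp g₂ * dY + mulOp g) d :=
  hn ▸ opL0_lie_of_isHomog hb h₁ h₂ hg

lemma hasDegree_opL1 (hx hy : ℂ) : HasDegree (opL0 hx hy) opL1 (-1) := by
  have h : opL1 = vecA (fun l => ((l : 𝓕) - 2) * a (l - 1)) + mulOp 1 * dX + mulOp 1 * dY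
      + mulOp 0 := by
    refine LinearMap.ext fun φ => ?_
    simp [opL1, mulOp]
  rw [h]
  refine hasDegree_of_isHomog (-1) (by norm_num) (fun l hl => ?_)
    (isHomog_one.of_eq (by norm_num)) (isHomog_one.of_eq (by norm_num)) (isHomog_zero _)
  exact (((isHomog_natCast l).sub (isHomog_ofNat 2)).const_mul (isHomog_a (l - 1))).of_eq
    (by omega)

lemma hasDegree_opL2 (hx hy : ℂ) : HasDegree (opL0 hx hy) opL2 (-2) := by
  set b : ℕ → 𝓕 := fun l => if l = 2 then -1 else ((l : 𝓕) - 3) * a (l - 2) with hb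
  have h : opL2 = vecA b + mulOp 0 * dX + mulOp 0 * dY + mulOp 0 := by
    refine LinearMap.ext fun φ => ?_
    simp [opL2, mulOp, hb]
  rw [h]
  refine hasDegree_of_isHomog (-2) (by norm_num) (fun l hl => ?_)
    (isHomog_zero _) (isHomog_zero _) (isHomog_zero _)
  rw [hb]
  dsimp only
  split_ifs with h2
  · subst h2
    exact isHomog_one.neg.of_eq (by norm_num)
  · exact (((isHomog_natCast l).sub (isHomog_ofNat 3)).const_mul (isHomog_a (l - 2))).of_eq
      (by omega)

lemma hasDegree_opLm1 (hx hy : ℂ) : HasDegree (opL0 hx hy) (opLm1 hx hy) 1 := by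
  rw [opLm1]
  refine hasDegree_of_isHomog 1 (by norm_num) (fun l hl => ?_)
    ((isHomog_x.pow 2).sub ((isHomog_ofNat 3).const_mul (isHomog_a 2)))
    ((isHomog_y.pow 2).sub ((isHomog_ofNat 3).const_mul (isHomog_a 2)))
    ((((isHomog_ofNat 2).const_mul isHomog_x).mul (isHomog_const hx)).add
      (((isHomog_ofNat 2).const_mul isHomog_y).mul (isHomog_const hy)))
  rw [add_comm, ← Nat.cast_succ]
  exact (((isHomog_natCast l).add (isHomog_ofNat 2)).const_mul (isHomog_a _)).add
    (isHomog_aSum _ _)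

lemma hasDegree_opLm2 (c hx hy : ℂ) :
    HasDegree (opL0 hx hy) (opLm2 c hx hy) 2 := by
  have hcoeff {z : 𝓕} (hz : IsHomog 1 z) : IsHomog (2 + 1) (z ^ 3 - 4 * z * a 2 - 5 * a 3) :=
    (((hz.pow 3).of_eq (by norm_num)).sub
      ((((isHomog_ofNat 4).const_mul hz).mul (isHomog_a 2)).of_eq (by norm_num))).sub
        (((isHomog_ofNat 5).const_mul (isHomog_a 3)).of_eq (by norm_num))
  have hquad {z : 𝓕} (hz : IsHomog 1 z) (t : ℂ) :
      IsHomog 2 ((3 * z ^ 2 - 4 * a 2) * const t) := by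
    have h₁ : IsHomog 2 (3 * z ^ 2) := (isHomog_ofNat 3).const_mul ((hz.pow 2).of_eq (by norm_num))
    have h₂ : IsHomog 2 (4 * a 2) := (isHomog_ofNat 4).const_mul (isHomog_a 2)
    exact ((h₁.sub h₂).mul (isHomog_const t)).of_eq (by norm_num)
  rw [opLm2]
  refine hasDegree_of_isHomog 2 (by norm_num) (fun l hl => ?_) (hcoeff isHomog_x)
    (hcoeff isHomog_y) (((hquad isHomog_x hx).add (hquad isHomog_y hy)).sub
      ((isHomog_const (c / 2)).const_mul (isHomog_a 2)))
  have e : (2 : ℤ) + l = ((l + 2 : ℕ) : ℤ) := by push_cast; ring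
  rw [e]
  refine (((((isHomog_natCast l).add (isHomog_ofNat 4)).const_mul (isHomog_a _)).sub ?_).add
    ((isHomog_ofNat 3).const_mul (isHomog_aSum _ _))).add (isHomog_aSum _ _)
  rw [← e]
  exact ((isHomog_ofNat 4).const_mul (isHomog_a 2)).mul (isHomog_a l)

/-- `[L₀, L_n] = -n L_n`. -/
lemma hasDegree_opL (c hx hy : ℂ) (n : ℤ) :
    HasDegree (opL c hx hy 0) (opL c hx hy n) (-n) := by
  change HasDegree (opL0 hx hy) _ _
  match n with
  | Int.ofNat 0 =>
    change HasDegree (opL0 hx hy) (opL0 hx hy) _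
    simp [HasDegree]
  | Int.ofNat 1 =>
    change HasDegree (opL0 hx hy) opL1 _
    simpa using hasDegree_opL1 hx hy
  | Int.ofNat (k + 2) =>
    refine HasDegree.smul ?_ _
    have key : HasDegree (opL0 hx hy) ((fun T : Op => ⁅T, opL1⁆)^[k] opL2) (-(k + 2)) := by
      induction k with
      | zero => simpa using hasDegree_opL2 hx hy
      | succ k ih =>
        rw [Function.iterate_succ_apply']
        exact (ih.lie (hasDegree_opL1 hx hy)).of_eq (by push_cast; ring)
    exact key.of_eq (by simp)
  | Int.negSucc 0 =>
    change HasDegree (opL0 hx hy) (opLm1 hx hy) _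
    simpa using hasDegree_opLm1 hx hy
  | Int.negSucc (k + 1) =>
    refine HasDegree.smul ?_ _
    have key : HasDegree (opL0 hx hy) ((fun T : Op => ⁅opLm1 hx hy, T⁆)^[k] (opLm2 c hx hy))
        (k + 2) := by
      induction k with
      | zero => simpa using hasDegree_opLm2 c hx hy
      | succ k ih =>
        rw [Function.iterate_succ_apply']
        exact ((hasDegree_opLm1 hx hy).lie ih).of_eq (by push_cast; ring)
    exact key.of_eq (by rw [Int.cast_negSucc]; push_cast; ring)

/-! ### Generated submodules and eigenspaces -/

section Modules

variable {V : Type*} [AddCommGroup V] [Module ℂ V] {L : ℤ → Module.End ℂ V}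

lemma mem_generated_self (w : V) : w ∈ generated L w :=
  ⟨1, one_mem (Algebra.adjoin ℂ (Set.range L)), rfl⟩

lemma apply_mem_generated {w v : V} (n : ℤ) (hv : v ∈ generated L w) :
    L n v ∈ generated L w := by
  obtain ⟨u, hu, rfl⟩ := hv
  exact ⟨L n * u, Subalgebra.mul_mem _ (Algebra.subset_adjoin ⟨n, rfl⟩) hu, rfl⟩

lemma generated_le {w : V} {N : Submodule ℂ V} (hN : ∀ n : ℤ, ∀ v ∈ N, L n v ∈ N)
    (hw : w ∈ N) : generated L w ≤ N := by
  rintro _ ⟨u, hu, rfl⟩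
  suffices h : ∀ v ∈ N, u v ∈ N from h w hw
  refine Algebra.adjoin_induction (p := fun u _ => ∀ v ∈ N, u v ∈ N) ?_ ?_ ?_ ?_ hu
  · rintro _ ⟨n, rfl⟩
    exact hN n
  · exact fun t v hv => N.smul_mem t hv
  · exact fun S T _ _ hS hT v hv => N.add_mem (hS v hv) (hT v hv)
  · exact fun S T _ _ hS hT v hv => hS _ (hT v hv)

/-- If the `L_n` shift the eigenvalues of `L₀`, then `L₀` is diagonalizable on the submodule
generated by an eigenvector. -/
lemma generated_le_iSup_eigenspace {d : ℤ → ℂ} (hL : ∀ n, HasDegree (L 0) (L n) (d n)) {w : V} {h : ℂ}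
    (hw : L 0 w = h • w) : generated L w ≤ ⨆ μ : ℂ, Module.End.eigenspace (L 0) μ := by
  refine generated_le (fun n v hv => ?_)
    (Submodule.mem_iSup_of_mem h (Module.End.mem_eigenspace_iff.2 hw))
  induction hv using Submodule.iSup_induction' with
  | mem μ v hv =>
    refine Submodule.mem_iSup_of_mem (d n + μ) (Module.End.mem_eigenspace_iff.2 ?_)
    have := LinearMap.congr_fun (hL n) v
    rw [Module.End.mem_eigenspace_iff] at hv
    rw [LinearMap.smul_apply, LinearMap.sub_apply, Module.End.mul_apply,
      Module.End.mul_apply, hv, map_smul, sub_eq_iff_eq_add] at this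
    rw [this, add_smul]
  | zero => simp
  | add v w _ _ hv hw => rw [map_add]; exact add_mem hv hw

/-- Jordan blocks of size two do not occur in a sum of eigenspaces. -/
lemma sub_smul_eq_zero_of_mem_iSup_eigenspace {T : Module.End ℂ V} {v : V} {t : ℂ}
    (hv : v ∈ ⨆ μ : ℂ, Module.End.eigenspace T μ)
    (ht : T (T v - t • v) = t • (T v - t • v)) : T v - t • v = 0 := by
  -- T - t kills the t-component and rescales the others. By `ht` the result is also in the
  -- t-eigenspace, and independence of eigenspaces forces it to vanish.
  have hmem : T v - t • v ∈ ⨆ (μ : ℂ) (_ : μ ≠ t), Module.End.eigenspace T μ := by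
    clear ht
    induction hv using Submodule.iSup_induction' with
    | mem μ v hv =>
      rcases eq_or_ne μ t with rfl | hμ
      · rw [Module.End.mem_eigenspace_iff.1 hv, sub_self]
        exact zero_mem _
      · refine Submodule.mem_iSup_of_mem μ (Submodule.mem_iSup_of_mem hμ ?_)
        rw [Module.End.mem_eigenspace_iff.1 hv, ← sub_smul]
        exact Submodule.smul_mem _ _ hv
    | zero => simp
    | add v w _ _ hv hw =>
      have : T (v + w) - t • (v + w) = (T v - t • v) + (T w - t • w) := by
        rw [map_add, smul_add]
        abel
      rw [this]
      exact add_mem hv hw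
  exact Submodule.disjoint_def.1 (Module.End.eigenspaces_iSupIndep T t) _
    (Module.End.mem_eigenspace_iff.2 ht) hmem

end Modules

/-! ### The operators on functions of `(x, y)` -/

lemma coe_add (f g : Smooth) : coe (f + g) = coe f + coe g := map_add _ f g

lemma coe_mul (f g : Smooth) : coe (f * g) = coe f * coe g := map_mul _ f g

lemma const_mul_coe (t : ℂ) (f : Smooth) : const t * coe f = coe (t • f) := by
  rw [const, MvPolynomial.algebraMap_apply, Algebra.smul_def]
  exact (coe_mul _ f).symm

lemma coe_smul (t : ℂ) (f : Smooth) : coe (t • f) = t • coe f := by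
  rw [← const_mul_coe, const, ← Algebra.smul_def]

lemma opL2_coe (f : Smooth) : opL2 (coe f) = 0 := vecA_coe _ f

lemma opL1_coe (f : Smooth) : opL1 (coe f) = coe (dirDeriv (1, 0) f + dirDeriv (0, 1) f) := by
  rw [opL1, LinearMap.add_apply, LinearMap.add_apply, vecA_coe, dX_coe, dY_coe, zero_add, coe_add]

lemma firstOrder_add_mulOp_coe (b : ℕ → 𝓕) (g₁ g₂ g : 𝓕) (f : Smooth) :
    (vecA b + mulOp g₁ * dX + mulOp g₂ * dY + mulOp g) (coe f)
      = g₁ * coe (dirDeriv (1, 0) f) + g₂ * coe (dirDeriv (0, 1) f) + g * coe f := by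
  rw [← firstOrder_coe b]
  rfl

lemma const_two : const 2 = 2 := map_ofNat (algebraMap ℂ 𝓕) 2

lemma const_three : const 3 = 3 := map_ofNat (algebraMap ℂ 𝓕) 3

lemma const_four : const 4 = 4 := map_ofNat (algebraMap ℂ 𝓕) 4

lemma const_five : const 5 = 5 := map_ofNat (algebraMap ℂ 𝓕) 5

lemma opL0_coe (hx hy : ℂ) (f : Smooth) : opL0 hx hy (coe f)
    = coe (xS * dirDeriv (1, 0) f + yS * dirDeriv (0, 1) f + (hx + hy) • f) := by
  rw [opL0, firstOrder_add_mulOp_coe, const_mul_coe, coe_add, coe_add, coe_mul, coe_mul, x, y]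

/-- The a₂-part sees f only through its translation derivative, so it disappears when f is
translation invariant. -/
lemma opLm1_coe (hx hy : ℂ) (f : Smooth) : opLm1 hx hy (coe f)
    = coe (xS ^ 2 * dirDeriv (1, 0) f + yS ^ 2 * dirDeriv (0, 1) f
        + (2 * hx) • (xS * f) + (2 * hy) • (yS * f))
      - a 2 * coe ((3 : ℂ) • (dirDeriv (1, 0) f + dirDeriv (0, 1) f)) := by
  have h2 (t : ℂ) : const (2 * t) = const 2 * const t := map_mul _ 2 t
  rw [opLm1, firstOrder_add_mulOp_coe]
  simp only [← const_mul_coe, coe_add, coe_mul, pow_two, x, y, h2, const_two, const_three]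
  ring

/-- Sorted by 1, a₂ and a₃, so that χZ can be compared coefficient by coefficient. -/
lemma opLm2_coe (c hx hy : ℂ) (f : Smooth) : opLm2 c hx hy (coe f)
    = coe (xS ^ 3 * dirDeriv (1, 0) f + yS ^ 3 * dirDeriv (0, 1) f
        + (3 * hx) • (xS ^ 2 * f) + (3 * hy) • (yS ^ 2 * f))
      - a 2 * coe ((4 : ℂ) • (xS * dirDeriv (1, 0) f + yS * dirDeriv (0, 1) f)
          + (4 * hx + 4 * hy + c / 2) • f)
      - a 3 * coe ((5 : ℂ) • (dirDeriv (1, 0) f + dirDeriv (0, 1) f)) := by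
  have h1 (s t : ℂ) : const (s * t) = const s * const t := map_mul _ s t
  have h2 (s t : ℂ) : const (s + t) = const s + const t := map_add _ s t
  rw [opLm2, firstOrder_add_mulOp_coe]
  simp only [← const_mul_coe, coe_add, coe_mul, pow_succ, pow_zero, one_mul, x, y, h1, h2,
    const_three, const_four, const_five]
  ring

lemma opA_coe (κ ρ : ℝ) (f : Smooth) : opA κ ρ (coe f)
    = coe (((κ / 2 : ℝ) : ℂ) • dirDeriv (1, 0) (dirDeriv (1, 0) f)
        + (2 : ℂ) • (invYX * dirDeriv (0, 1) f)
        + (-(ρ * (ρ + 4 - κ) / (2 * κ) : ℝ) : ℂ) • (invYX ^ 2 * f)) := by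
  have h1 (t : ℂ) : const (-t) = -const t := map_neg _ t
  rw [opA, LinearMap.add_apply, vecA_coe, add_zero]
  change ((κ / 2 : ℝ) : ℂ) • dX (dX (coe f)) + 2 * coe invYX * dY (coe f)
    - const (ρ * (ρ + 4 - κ) / (2 * κ) : ℝ) * coe invYX ^ 2 * coe f = _
  rw [dX_coe, dX_coe, dY_coe, ← coe_smul]
  simp only [← const_mul_coe, coe_add, coe_mul, pow_two, h1, const_two]
  ring

lemma opL_coe_of_two_le (c hx hy : ℂ) {n : ℤ} (hn : 2 ≤ n) (f : Smooth) :
    opL c hx hy n (coe f) = 0 := by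
  obtain ⟨k, rfl⟩ : ∃ k : ℕ, n = Int.ofNat (k + 2) :=
    ⟨(n - 2).toNat, by rw [Int.ofNat_eq_natCast]; push_cast; omega⟩
  -- The induction needs all f at once: the bracket applies the previous operator to L₁f, which is
  -- again free of the a_l.
  have key : ∀ f : Smooth, ((fun T : Op => ⁅T, opL1⁆)^[k] opL2) (coe f) = 0 := by
    clear hn
    induction k with
    | zero => exact opL2_coe
    | succ k ih =>
      intro f
      rw [Function.iterate_succ_apply', Ring.lie_def, LinearMap.sub_apply, Module.End.mul_apply,
        Module.End.mul_apply, ih, opL1_coe, ih, map_zero, sub_zero]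
  change ((k.factorial : ℂ)⁻¹) • ((fun T : Op => ⁅T, opL1⁆)^[k] opL2) (coe f) = 0
  rw [key, smul_zero]

/-! ### The functions Z and Λ and the drift operator -/

lemma dirDeriv_pow_two (v : ℝ × ℝ) (f : Smooth) :
    dirDeriv v (f ^ 2) = (2 : ℂ) • (f * dirDeriv v f) := by
  rw [pow_two, dirDeriv_mul, two_smul]

lemma dirDeriv_algebraMap (v : ℝ × ℝ) (t : ℂ) : dirDeriv v (algebraMap ℂ Smooth t) = 0 :=
  (dirDer v).map_algebraMap t

lemma cpow_add_two (p : Dom) {s t : ℝ} (h : t = s + 2) :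
    diff p ^ (t : ℂ) = diff p ^ (s : ℂ) * diff p ^ 2 := by
  rw [h, Complex.ofReal_add, Complex.cpow_add _ _ (diff_ne_zero p)]
  norm_num

/-- The exponent `-1/2 - 2/κ` of the partition function. -/
def expZ (κ : ℝ) : ℝ := -(1 / 2) - 2 / κ

/-- The function `(x - y)^{-1/2 - 2/κ}`. -/
def fZ (κ : ℝ) : Smooth := powXY (expZ κ)

/-- The logarithmic partner as a smooth function. -/
def fΛ (κ : ℝ) : Smooth := (singConst κ : ℂ) •
  (powXY (expZ κ + 2) * logXY + fZ κ *
    ((1 / 16 : ℂ) • ((4 * κ : ℂ) • xS ^ 2 - (4 * κ + κ ^ 2 : ℂ) • yS ^ 2)))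

lemma partitionFunction_eq {κ : ℝ} (hκ : κ ≠ 0) :
    partitionFunction κ (-(κ + 4) / 2) = coe (fZ κ) := by
  rw [partitionFunction, fZ, expZ]
  congr 2
  field_simp
  ring

lemma logPartner_eq {κ : ℝ} (hκ : κ ≠ 0) : logPartner κ = coe (fΛ κ) := by
  have h1 : (3 * κ - 4) / (2 * κ) = expZ κ + 2 := by
    rw [expZ]
    field_simp
    ring
  have h2 : (-κ - 4) / (2 * κ) = expZ κ := by
    rw [expZ]
    field_simp
    ring
  rw [logPartner, fΛ, fZ, h1, h2]

lemma dirDeriv_fZ (v : ℝ × ℝ) (κ : ℝ) :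
    dirDeriv v (fZ κ) = ((v.2 - v.1 : ℝ) * (expZ κ : ℂ)) • (fZ κ * invYX) :=
  dirDeriv_powXY v _

lemma ev_fZ (κ : ℝ) (p : Dom) : ev p (fZ κ) = diff p ^ (expZ κ : ℂ) := ev_powXY _ p

/-- The drift operator multiplies (x-y)^s by (x-y)^(-2) and a quadratic polynomial in s; its roots
are `expZ κ` and `expZ κ + 2`. -/
lemma opA_fZ {κ : ℝ} (hκ : κ ≠ 0) : opA κ (-(κ + 4) / 2) (coe (fZ κ)) = 0 := by
  have hκ' : (κ : ℂ) ≠ 0 := Complex.ofReal_ne_zero.2 hκ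
  rw [opA_coe, ← map_zero MvPolynomial.C]
  refine congrArg _ (smooth_ext fun p => ?_)
  have hd := diff_ne_zero p
  simp only [dirDeriv_fZ, dirDeriv_mul, dirDeriv_invYX, map_add, map_mul, map_smul,
    map_pow, map_zero, ev_fZ, ev_invYX, smul_eq_mul]
  generalize diff p ^ (expZ κ : ℂ) = P
  rw [expZ]
  push_cast
  field_simp
  ring

/-- As `expZ κ + 2` is an indicial root, the logarithmic term contributes only the derivative of the
indicial polynomial there, namely κZ. The quadratic term contributes -κZ. -/
lemma opA_fΛ {κ : ℝ} (hκ : κ ≠ 0) : opA κ (-(κ + 4) / 2) (coe (fΛ κ)) = 0 := by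
  have hκ' : (κ : ℂ) ≠ 0 := Complex.ofReal_ne_zero.2 hκ
  rw [opA_coe, ← map_zero MvPolynomial.C]
  refine congrArg _ (smooth_ext fun p => ?_)
  have hd := diff_ne_zero p
  simp only [fΛ, dirDeriv_fZ, dirDeriv_powXY, dirDeriv_logXY, dirDeriv_xS, dirDeriv_yS,
    dirDeriv_mul, dirDeriv_invYX, dirDeriv_pow_two, dirDeriv_algebraMap,
    map_add, map_sub, map_mul, map_smul, AlgHom.commutes, Algebra.algebraMap_self_apply,
    map_pow, map_zero, ev_fZ, ev_powXY, ev_logXY, ev_xS, ev_yS, ev_invYX, smul_eq_mul,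
    cpow_add_two p (s := expZ κ) rfl]
  -- With the power and the logarithm opaque and x written as (x-y)+y, a rational identity in κ,
  -- x-y, y, P and l remains.
  generalize diff p ^ (expZ κ : ℂ) = P
  generalize Complex.log (diff p) = l
  have hx : (p.1.1 : ℂ) = diff p + p.1.2 := by rw [diff]; ring
  rw [hx, expZ]
  push_cast
  field_simp
  ring

lemma coe_injective : Function.Injective coe := MvPolynomial.C_injective Idx Smooth

lemma powXY_ne_zero (s : ℝ) : powXY s ≠ 0 := by
  intro h
  have h1 := ev_powXY s ⟨(1, 0), one_ne_zero⟩
  rw [h, map_zero] at h1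
  simp [diff] at h1

lemma coe_powXY_ne_zero (s : ℝ) : coe (powXY s) ≠ 0 :=
  fun h => powXY_ne_zero s (coe_injective (h.trans (map_zero MvPolynomial.C).symm))

/-! ### The generators for `ρ = -(κ+4)/2` -/

/-- The weight `h_x`, as a complex number. -/
def wX (κ : ℝ) : ℂ := (kacWeight κ 1 2 : ℝ)

/-- The weight `h_y` for `ρ = -(κ+4)/2`, as a complex number. -/
def wY (κ : ℝ) : ℂ := (-(κ + 4) / 2 * (-(κ + 4) / 2 + 4 - κ) / (4 * κ) : ℝ)

lemma wX_eq (κ : ℝ) : wX κ = 3 / κ - 1 / 2 := by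
  rw [wX, kacWeight]
  push_cast
  ring

lemma wY_eq (κ : ℝ) : wY κ = (κ + 4) * (3 * κ - 4) / (16 * κ) := by
  rw [wY]
  push_cast
  ring

lemma vir_zero (κ : ℝ) : vir κ (-(κ + 4) / 2) 0 = opL0 (wX κ) (wY κ) := rfl

lemma vir_one (κ ρ : ℝ) : vir κ ρ 1 = opL1 := rfl

lemma vir_two (κ ρ : ℝ) : vir κ ρ 2 = opL2 := by
  change ((Nat.factorial 0 : ℂ)⁻¹) • opL2 = opL2
  simp

lemma vir_neg_one (κ : ℝ) : vir κ (-(κ + 4) / 2) (-1) = opLm1 (wX κ) (wY κ) := rfl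

lemma vir_neg_two (κ : ℝ) :
    vir κ (-(κ + 4) / 2) (-2) = opLm2 (centralCharge κ : ℝ) (wX κ) (wY κ) := by
  change ((Nat.factorial 0 : ℂ)⁻¹) • opLm2 (centralCharge κ : ℝ) (wX κ) (wY κ) = _
  simp

lemma opL0_fZ {κ : ℝ} (hκ : κ ≠ 0) :
    opL0 (wX κ) (wY κ) (coe (fZ κ)) = ((kacWeight κ 2 1 : ℝ) : ℂ) • coe (fZ κ) := by
  have hκ' : (κ : ℂ) ≠ 0 := Complex.ofReal_ne_zero.2 hκ
  rw [opL0_coe, ← coe_smul]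
  refine congrArg _ (smooth_ext fun p => ?_)
  have hd := diff_ne_zero p
  simp only [dirDeriv_fZ, map_add, map_mul, map_smul, ev_fZ, ev_xS, ev_yS, ev_invYX, smul_eq_mul]
  generalize diff p ^ (expZ κ : ℂ) = P
  have hx : (p.1.1 : ℂ) = diff p + p.1.2 := by rw [diff]; ring
  rw [hx, expZ, wX_eq, wY_eq, kacWeight]
  push_cast
  field_simp
  ring

lemma opL1_fZ (κ : ℝ) : opL1 (coe (fZ κ)) = 0 := by
  rw [opL1_coe, ← map_zero MvPolynomial.C]
  refine congrArg _ (smooth_ext fun p => ?_)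
  simp only [dirDeriv_fZ, map_add, map_mul, map_smul, map_zero, smul_eq_mul]
  push_cast
  ring

/-- Translation invariance of functions of x-y. -/
lemma opL1_powXY (s : ℝ) : opL1 (coe (powXY s)) = 0 := by
  rw [opL1_coe, ← map_zero MvPolynomial.C]
  refine congrArg _ (smooth_ext fun p => ?_)
  simp only [dirDeriv_powXY, map_add, map_mul, map_smul, map_zero, smul_eq_mul]
  push_cast
  ring

/-- `L₋₁ Z`, as a smooth function. -/
def fDesc (κ : ℝ) : Smooth :=
  ((8 - 3 * κ : ℂ) / (2 * κ)) • (xS * fZ κ) + ((κ + 4 : ℂ) * (3 * κ - 8) / (8 * κ)) • (yS * fZ κ)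

lemma opLm1_fZ {κ : ℝ} (hκ : κ ≠ 0) : opLm1 (wX κ) (wY κ) (coe (fZ κ)) = coe (fDesc κ) := by
  have hκ' : (κ : ℂ) ≠ 0 := Complex.ofReal_ne_zero.2 hκ
  rw [opLm1_coe]
  have h0 : dirDeriv (1, 0) (fZ κ) + dirDeriv (0, 1) (fZ κ) = 0 := by
    refine smooth_ext fun p => ?_
    simp only [dirDeriv_fZ, map_add, map_mul, map_smul, map_zero, smul_eq_mul]
    push_cast
    ring
  rw [h0, smul_zero, coe, coe, map_zero, mul_zero, sub_zero]
  refine congrArg _ (smooth_ext fun p => ?_)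
  have hd := diff_ne_zero p
  simp only [fDesc, dirDeriv_fZ, map_add, map_mul, map_smul, map_pow, ev_fZ, ev_xS, ev_yS,
    ev_invYX, smul_eq_mul]
  generalize diff p ^ (expZ κ : ℂ) = P
  have hx : (p.1.1 : ℂ) = diff p + p.1.2 := by rw [diff]; ring
  rw [hx, expZ, wX_eq, wY_eq]
  push_cast
  field_simp
  ring

/-- The vector `(L₋₁² - κ/4 L₋₂) Z`. -/
lemma singular_fZ {κ : ℝ} (hκ : κ ≠ 0) :
    opLm1 (wX κ) (wY κ) (coe (fDesc κ))
        - ((κ / 4 : ℝ) : ℂ) • opLm2 (centralCharge κ : ℝ) (wX κ) (wY κ) (coe (fZ κ))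
      = coe ((singConst κ : ℂ) • powXY (expZ κ + 2)) := by
  have hκ' : (κ : ℂ) ≠ 0 := Complex.ofReal_ne_zero.2 hκ
  -- Separates the coefficients of 1, a₂ and a₃; only L₋₂ produces an a₃-term.
  have key {F₁ F₂ G₁ G₂ K H : Smooth} {t : ℂ} (hF : F₁ - t • F₂ = H) (hG : G₁ - t • G₂ = 0)
      (hK : K = 0) :
      (coe F₁ - a 2 * coe G₁) - t • (coe F₂ - a 2 * coe G₂ - a 3 * coe K) = coe H := by
    have h₁ : F₁ = H + t • F₂ := sub_eq_iff_eq_add.1 hF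
    have h₂ : coe 0 = 0 := map_zero MvPolynomial.C
    rw [hK, h₁, sub_eq_zero.1 hG, coe_add, coe_smul, coe_smul, h₂, mul_zero, sub_zero, smul_sub,
      mul_smul_comm]
    ring
  rw [opLm1_coe, opLm2_coe]
  refine key ?_ ?_ ?_
  · refine smooth_ext fun p => ?_
    have hd := diff_ne_zero p
    simp only [fDesc, dirDeriv_fZ, dirDeriv_xS, dirDeriv_yS, dirDeriv_mul, map_sub,
      map_add, map_mul, map_smul, AlgHom.commutes, Algebra.algebraMap_self_apply,
      map_pow, ev_fZ, ev_powXY, ev_xS, ev_yS, ev_invYX, smul_eq_mul,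
      cpow_add_two p (s := expZ κ) rfl]
    generalize diff p ^ (expZ κ : ℂ) = P
    have hx : (p.1.1 : ℂ) = diff p + p.1.2 := by rw [diff]; ring
    rw [hx, wX_eq, wY_eq, singConst, expZ]
    push_cast
    field_simp
    ring
  -- The a₂-coefficient cancels thanks to the value of the central charge, which enters only here.
  · refine smooth_ext fun p => ?_
    have hd := diff_ne_zero p
    simp only [fDesc, dirDeriv_fZ, dirDeriv_xS, dirDeriv_yS, dirDeriv_mul, map_sub,
      map_add, map_mul, map_smul, AlgHom.commutes, Algebra.algebraMap_self_apply,
      map_zero, ev_fZ, ev_xS, ev_yS, ev_invYX, smul_eq_mul]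
    generalize diff p ^ (expZ κ : ℂ) = P
    have hx : (p.1.1 : ℂ) = diff p + p.1.2 := by rw [diff]; ring
    rw [hx, wX_eq, wY_eq, centralCharge, expZ]
    push_cast
    field_simp
    ring
  · refine smooth_ext fun p => ?_
    simp only [dirDeriv_fZ, map_add, map_mul, map_smul, map_zero, smul_eq_mul]
    push_cast
    ring

lemma opL0_powXY {κ : ℝ} (hκ : κ ≠ 0) :
    opL0 (wX κ) (wY κ) (coe (powXY (expZ κ + 2)))
      = (((kacWeight κ 2 1 : ℝ) : ℂ) + 2) • coe (powXY (expZ κ + 2)) := by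
  have hκ' : (κ : ℂ) ≠ 0 := Complex.ofReal_ne_zero.2 hκ
  rw [opL0_coe, ← coe_smul]
  refine congrArg _ (smooth_ext fun p => ?_)
  have hd := diff_ne_zero p
  simp only [dirDeriv_powXY, map_add, map_mul, map_smul, ev_powXY, ev_xS, ev_yS, ev_invYX,
    smul_eq_mul]
  generalize diff p ^ ((expZ κ + 2 : ℝ) : ℂ) = P
  have hx : (p.1.1 : ℂ) = diff p + p.1.2 := by rw [diff]; ring
  rw [hx, expZ, wX_eq, wY_eq, kacWeight]
  push_cast
  field_simp
  ring

/-- Apart from the logarithm, both terms are homogeneous of degree `expZ κ + 2`, hence of weight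
h₂,₁+2. The defect comes from the Euler field, which sends log(x-y) to 1. -/
lemma opL0_fΛ {κ : ℝ} (hκ : κ ≠ 0) :
    opL0 (wX κ) (wY κ) (coe (fΛ κ)) - (((kacWeight κ 2 1 : ℝ) : ℂ) + 2) • coe (fΛ κ)
      = coe ((singConst κ : ℂ) • powXY (expZ κ + 2)) := by
  have hκ' : (κ : ℂ) ≠ 0 := Complex.ofReal_ne_zero.2 hκ
  rw [opL0_coe, ← coe_smul, sub_eq_iff_eq_add, ← coe_add]
  refine congrArg _ (smooth_ext fun p => ?_)
  have hd := diff_ne_zero p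
  simp only [fΛ, dirDeriv_fZ, dirDeriv_powXY, dirDeriv_logXY, dirDeriv_xS, dirDeriv_yS,
    dirDeriv_mul, dirDeriv_pow_two,
    map_add, map_sub, map_mul, map_smul, AlgHom.commutes, Algebra.algebraMap_self_apply,
    map_pow, ev_fZ, ev_powXY, ev_logXY, ev_xS, ev_yS, ev_invYX, smul_eq_mul,
    cpow_add_two p (s := expZ κ) rfl]
  generalize diff p ^ (expZ κ : ℂ) = P
  generalize Complex.log (diff p) = l
  have hx : (p.1.1 : ℂ) = diff p + p.1.2 := by rw [diff]; ring
  rw [hx, expZ, wX_eq, wY_eq, kacWeight]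
  push_cast
  field_simp
  ring

/-- `L₁ Λ`, as a smooth function. -/
def fRais (κ : ℝ) : Smooth :=
  (singConst κ : ℂ) • ((κ / 2 : ℂ) • (xS * fZ κ) - ((4 * κ + κ ^ 2) / 8 : ℂ) • (yS * fZ κ))

/-- Powers and logarithm of x-y are translation invariant, so only the quadratic polynomial is
differentiated. -/
lemma opL1_fΛ (κ : ℝ) : opL1 (coe (fΛ κ)) = coe (fRais κ) := by
  rw [opL1_coe]
  refine congrArg _ (smooth_ext fun p => ?_)
  simp only [fΛ, fRais, dirDeriv_fZ, dirDeriv_powXY, dirDeriv_logXY, dirDeriv_xS, dirDeriv_yS,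
    dirDeriv_mul, dirDeriv_pow_two,
    map_add, map_sub, map_mul, map_smul, AlgHom.commutes, Algebra.algebraMap_self_apply,
    map_pow, ev_powXY, smul_eq_mul]
  push_cast
  ring

/-- The second translation derivative of the quadratic polynomial is -κ²/8; times `singConst κ` this
is β. -/
lemma opL1_fRais {κ : ℝ} (hκ : κ ≠ 0) : opL1 (coe (fRais κ))
    = ((-(1 / 16) * (κ - 4) * (κ - 2) * (κ + 4) : ℝ) : ℂ) • coe (fZ κ) := by
  have hκ' : (κ : ℂ) ≠ 0 := Complex.ofReal_ne_zero.2 hκ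
  rw [opL1_coe, ← coe_smul]
  refine congrArg _ (smooth_ext fun p => ?_)
  simp only [fRais, dirDeriv_fZ, dirDeriv_xS, dirDeriv_yS, dirDeriv_mul,
    map_add, map_sub, map_mul, map_smul, AlgHom.commutes, Algebra.algebraMap_self_apply,
    smul_eq_mul]
  rw [singConst]
  push_cast
  field_simp
  ring

/-- Both sides are multiples of (x - (κ+4)y/4)Z. At κ = 8/3 the weight h₂,₁ is zero and L₋₁Z
vanishes, hence the exclusion. -/
lemma coe_fRais {κ : ℝ} (hκ : κ ≠ 0) (h : κ ≠ 8 / 3) : coe (fRais κ)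
    = ((singConst κ : ℂ) * κ ^ 2 / (8 - 3 * κ)) • coe (fDesc κ) := by
  have hκ' : (κ : ℂ) ≠ 0 := Complex.ofReal_ne_zero.2 hκ
  have h8 : (8 - 3 * κ : ℂ) ≠ 0 := by
    have : (8 - 3 * κ : ℝ) ≠ 0 := fun h' => h (by linarith)
    exact_mod_cast this
  rw [← coe_smul]
  refine congrArg _ (smooth_ext fun p => ?_)
  simp only [fRais, fDesc, map_add, map_sub, map_mul, map_smul, smul_eq_mul]
  -- Writes both coefficients of `fDesc` through the same factor 8-3κ, which then cancels.
  rw [← neg_sub (8 : ℂ)]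
  generalize (8 - 3 * κ : ℂ) = r at h8 ⊢
  field_simp
  ring

/-! ### Singular vectors and membership in 𝒰Z -/

lemma singConst_ne_zero {κ : ℝ} (hκ : 0 < κ) (h2 : κ ≠ 2) (h4 : κ ≠ 4) : singConst κ ≠ 0 := by
  have h := sub_ne_zero.2 h2
  have h' := sub_ne_zero.2 h4
  rw [singConst]
  positivity

lemma isHighestWeightVector_powXY {κ : ℝ} (hκ : κ ≠ 0) {t : ℂ} (ht : t ≠ 0) :
    IsHighestWeightVector (vir κ (-(κ + 4) / 2)) (((kacWeight κ 2 1 : ℝ) : ℂ) + 2)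
      (coe (t • powXY (expZ κ + 2))) := by
  rw [coe_smul]
  refine ⟨smul_ne_zero ht (coe_powXY_ne_zero _), ?_, fun n hn => ?_⟩
  · rw [map_smul, vir_zero, opL0_powXY hκ, smul_comm]
  · rw [map_smul]
    obtain rfl | hn : n = 1 ∨ 2 ≤ n := by omega
    · rw [vir_one, opL1_powXY, smul_zero]
    · rw [vir, opL_coe_of_two_le _ _ _ hn, smul_zero]

lemma isHighestWeightVector_fZ {κ : ℝ} (hκ : κ ≠ 0) :
    IsHighestWeightVector (vir κ (-(κ + 4) / 2)) (kacWeight κ 2 1 : ℝ) (coe (fZ κ)) := by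
  refine ⟨coe_powXY_ne_zero _, opL0_fZ hκ, fun n hn => ?_⟩
  obtain rfl | hn : n = 1 ∨ 2 ≤ n := by omega
  · rw [vir_one, opL1_fZ]
  · rw [vir, opL_coe_of_two_le _ _ _ hn]

lemma vir_fΛ_mem_generated {κ : ℝ} (hκ : κ ≠ 0) (h : κ ≠ 8 / 3) {n : ℤ} (hn : 0 < n) :
    vir κ (-(κ + 4) / 2) n (coe (fΛ κ)) ∈ generated (vir κ (-(κ + 4) / 2)) (coe (fZ κ)) := by
  obtain rfl | hn : n = 1 ∨ 2 ≤ n := by omega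
  · rw [vir_one, opL1_fΛ, coe_fRais hκ h, ← opLm1_fZ hκ, ← vir_neg_one]
    exact Submodule.smul_mem _ _ (apply_mem_generated _ (mem_generated_self _))
  · rw [vir, opL_coe_of_two_le _ _ _ hn]
    exact zero_mem _

end SLEVir

end

/-! ### Assembly of the staggered module -/

theorem mainTheorem4 (κ : ℝ) (hκ : 0 < κ) :
    let ρ : ℝ := -(κ + 4) / 2
    let L : ℤ → SLEVir.Op := SLEVir.vir κ ρ
    let h : ℂ := (SLEVir.kacWeight κ 2 1 : ℝ)
    let Z : SLEVir.𝓕 := SLEVir.partitionFunction κ ρ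
    let χ : SLEVir.Op := L (-1) ^ 2 - ((κ / 4 : ℝ) : ℂ) • L (-2)
    let χd : SLEVir.Op := L 1 ^ 2 - ((κ / 4 : ℝ) : ℂ) • L 2
    let Λ : SLEVir.𝓕 := SLEVir.logPartner κ
    let β : ℂ := ((-(1 / 16) * (κ - 4) * (κ - 2) * (κ + 4) : ℝ) : ℂ)
    -- `Z = (x - y)^{-1/2 - 2/κ}` is a local martingale, a highest weight vector of weight `h_{2,1}`
    Z = SLEVir.coe (SLEVir.powXY (-(1 / 2) - 2 / κ)) ∧
    Z ∈ SLEVir.localMartingales κ ρ ∧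
    SLEVir.kacWeight κ 2 1 = (3 * κ - 8) / 16 ∧
    SLEVir.IsHighestWeightVector L h Z ∧
    -- the vector at grade two of `𝒰 Z`; it is a nonzero singular vector if `κ ≠ 2, 4`
    χ Z = (SLEVir.singConst κ : ℂ) • SLEVir.coe (SLEVir.powXY (3 / 2 - 2 / κ)) ∧
    (κ ≠ 2 → κ ≠ 4 → SLEVir.IsHighestWeightVector L (h + 2) (χ Z)) ∧
    -- the logarithmic partner
    Λ ∈ SLEVir.localMartingales κ ρ ∧
    L 0 Λ - (h + 2) • Λ = χ Z ∧
    (κ ≠ 8 / 3 → ∀ n : ℤ, 0 < n → L n Λ ∈ SLEVir.generated L Z) ∧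
    -- the logarithmic coupling
    χd Λ = β • Z ∧
    (κ ≠ 2 → κ ≠ 4 → κ ≠ 8 / 3 →
      SLEVir.IsStaggered L (SLEVir.generated L Z) (SLEVir.generated L Λ) h (h + 2) ∧
      SLEVir.IsLogCoupling L (SLEVir.generated L Z) (SLEVir.generated L Λ) h (h + 2) χ χd β) := by
  intro ρ L h Z χ χd Λ β
  have hκ0 : κ ≠ 0 := hκ.ne'
  have hZ : Z = SLEVir.coe (SLEVir.fZ κ) := SLEVir.partitionFunction_eq hκ0
  have hΛ : Λ = SLEVir.coe (SLEVir.fΛ κ) := SLEVir.logPartner_eq hκ0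
  have hLm1 : L (-1) = SLEVir.opLm1 (SLEVir.wX κ) (SLEVir.wY κ) := SLEVir.vir_neg_one κ
  have hLm2 : L (-2) = SLEVir.opLm2 (SLEVir.centralCharge κ : ℝ) (SLEVir.wX κ) (SLEVir.wY κ) :=
    SLEVir.vir_neg_two κ
  have hL1 : L 1 = SLEVir.opL1 := SLEVir.vir_one κ ρ
  have hL2 : L 2 = SLEVir.opL2 := SLEVir.vir_two κ ρ
  have hχ : χ Z = SLEVir.coe ((SLEVir.singConst κ : ℂ) • SLEVir.powXY (SLEVir.expZ κ + 2)) := by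
    have e : χ Z = L (-1) (L (-1) Z) - ((κ / 4 : ℝ) : ℂ) • L (-2) Z := by
      simp only [χ, pow_two]
      rfl
    rw [e, hZ, hLm1, hLm2, SLEVir.opLm1_fZ hκ0,
      SLEVir.singular_fZ hκ0]
  have hχd : χd Λ = β • Z := by
    have e : χd Λ = L 1 (L 1 Λ) - ((κ / 4 : ℝ) : ℂ) • L 2 Λ := by
      simp only [χd, pow_two]
      rfl
    rw [e, hΛ, hZ, hL1, hL2, SLEVir.opL1_fΛ, SLEVir.opL1_fRais hκ0,
      SLEVir.opL2_coe, smul_zero, sub_zero]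
  have hZw : SLEVir.IsHighestWeightVector L h Z := hZ ▸ SLEVir.isHighestWeightVector_fZ hκ0
  have hχw (h2 : κ ≠ 2) (h4 : κ ≠ 4) : SLEVir.IsHighestWeightVector L (h + 2) (χ Z) :=
    hχ ▸ SLEVir.isHighestWeightVector_powXY hκ0
      (Complex.ofReal_ne_zero.2 (SLEVir.singConst_ne_zero hκ h2 h4))
  have hL0 : L 0 Λ - (h + 2) • Λ = χ Z := by
    rw [hχ, hΛ]
    exact SLEVir.opL0_fΛ hκ0
  have hpos (h8 : κ ≠ 8 / 3) (n : ℤ) (hn : 0 < n) : L n Λ ∈ SLEVir.generated L Z := by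
    rw [hΛ, hZ]
    exact SLEVir.vir_fΛ_mem_generated hκ0 h8 hn
  refine ⟨hZ, ?_, ?_, hZw, ?_, hχw, ?_, hL0, hpos, hχd, fun h2 h4 h8 => ?_⟩
  · rw [hZ]
    exact SLEVir.opA_fZ hκ0
  · rw [SLEVir.kacWeight]
    push_cast
    ring
  · rw [hχ, SLEVir.coe_smul, SLEVir.expZ,
      show -(1 / 2) - 2 / κ + 2 = 3 / 2 - 2 / κ by ring]
  · rw [hΛ]
    exact SLEVir.opA_fΛ hκ0
  -- This one fact yields both Λ ∉ 𝒰Z and the failure of diagonalizability on 𝒰Λ.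
  have hnot : Λ ∉ ⨆ μ : ℂ, Module.End.eigenspace (L 0) μ := by
    intro hmem
    have h0 := SLEVir.sub_smul_eq_zero_of_mem_iSup_eigenspace hmem (t := h + 2)
      (by rw [hL0]; exact (hχw h2 h4).2.1)
    exact (hχw h2 h4).1 (hL0.symm.trans h0)
  have hβ : β ≠ 0 := by
    have h2' := sub_ne_zero.2 h2
    have h4' := sub_ne_zero.2 h4
    have : (κ + 4) ≠ 0 := by positivity
    exact Complex.ofReal_ne_zero.2 (by simp [*])
  have hΛS : Λ ∈ SLEVir.generated L Λ := SLEVir.mem_generated_self Λ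
  have hinv : ∀ n : ℤ, ∀ v ∈ SLEVir.generated L Λ, L n v ∈ SLEVir.generated L Λ :=
    fun n v hv => SLEVir.apply_mem_generated n hv
  -- Z = β⁻¹χ†Λ; here κ ≠ 2, 4 is used through β ≠ 0.
  have hZS : Z ∈ SLEVir.generated L Λ := by
    have e : Z = β⁻¹ • (L 1 (L 1 Λ) - ((κ / 4 : ℝ) : ℂ) • L 2 Λ) := by
      rw [eq_inv_smul_iff₀ hβ, ← hχd]
      simp only [χd, pow_two]
      rfl
    rw [e]
    exact Submodule.smul_mem _ _ (sub_mem (hinv 1 _ (hinv 1 _ hΛS))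
      (Submodule.smul_mem _ _ (hinv 2 _ hΛS)))
  have hle : SLEVir.generated L Z ≤ SLEVir.generated L Λ := SLEVir.generated_le hinv hZS
  have hχZ : χ Z ∈ SLEVir.generated L Z := by
    have e : χ Z = L (-1) (L (-1) Z) - ((κ / 4 : ℝ) : ℂ) • L (-2) Z := by
      simp only [χ, pow_two]
      rfl
    have hself := SLEVir.mem_generated_self (L := L) Z
    rw [e]
    exact sub_mem (SLEVir.apply_mem_generated _ (SLEVir.apply_mem_generated _ hself))
      (Submodule.smul_mem _ _ (SLEVir.apply_mem_generated _ hself))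
  have hmod : SLEVir.IsHighestWeightVectorMod L (SLEVir.generated L Z) (SLEVir.generated L Λ)
      (h + 2) Λ := by
    refine ⟨hΛS, fun hmem => hnot ?_, hL0 ▸ hχZ, hpos h8, sup_eq_right.2 hle⟩
    -- Z is an L₀-eigenvector, so by the grading all of 𝒰Z lies in the sum of the eigenspaces, where
    -- Λ cannot be.
    exact SLEVir.generated_le_iSup_eigenspace (SLEVir.hasDegree_opL _ _ _) hZw.2.1 hmem
  refine ⟨⟨hle, hinv, ⟨Z, hZw, rfl⟩, ⟨Λ, hmod⟩, fun hS => hnot ?_⟩,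
    ⟨Z, Λ, hZw, rfl, hmod, hχw h2 h4, hL0, hχd⟩⟩
  have hmono : (⨆ μ : ℂ, SLEVir.generated L Λ ⊓ Module.End.eigenspace (L 0) μ)
      ≤ ⨆ μ : ℂ, Module.End.eigenspace (L 0) μ := iSup_mono fun μ => inf_le_right
  exact hmono (by rw [hS]; exact hΛS)
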